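/- **Setting.** Let $H$ be a complex Hilbert space and let $A:D(A)\subset H\to H$ be self-adjoint or skew-adjoint, with an orthonormal basis of eigenvectors $(\varphi_n)_{n\ge 1}$, $A\varphi_n=\lambda_n\varphi_n$, where $0<-\lambda_1\le-\lambda_2\le\dots$ if $A$ is self-adjoint, and $0<-i\lambda_1\le -i\lambda_2\le\dots$ if $A$ is skew-adjoint. Let $B\in D(A)'$ (scalar control; $D(A)'$ is the space of continuous antilinear functionals on $D(A)$ with the graph norm, so that $H\subset D(A)'$ linearly), and put $b_n=\langle B,\varphi_n\rangle$. Assume that there are $\alpha>1$ and $c_0,C_0>0$ such that, for all $n,k\ge 1$, $$c_0\le |b_n|\le C_0,\qquad c_0n^{\alpha-1}\le|\lambda_{n+1}-\lambda_n|\le C_0n^{\alpha-1},\qquad c_0k^{\alpha-1}|k-n|\le|\lambda_k-\lambda_n|.$$ For $s\ge 0$ let $D(A^s)=\{f\in H:\ \|f\|_{D(A^s)}^2:=\sum_n|\lambda_n|^{2s}|\langle f,\varphi_n\rangle|^2<\infty\}$. Let $\mathcal N=\{\lambda_i-\lambda_j: i,j\ge 1\}$; a number $\lambda\notin\mathcal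 N$ is called non-resonant. For a non-resonant $\lambda>0$ define the feedback $K_\lambda f=\sum_n k_n\langle f,\varphi_n\rangle$ (on the $f\in H$ for which the series converges absolutely), where $$k_nb_n=\sum_{j\ge 1}\frac{\lambda^2}{\lambda_j-\lambda_n-\lambda}\prod_{m\ne n}\Big(1+\frac{\lambda}{\lambda_n-\lambda_m}\Big)\prod_{m\neq j}\Big(1-\frac{\lambda}{\lambda_j-\lambda_m}\Big).$$ On $D(A^s)$ the closed-loop operator $A+BK_\lambda$ has as its domain the set of all $f\in D(A^s)$ such that $K_\lambda f$ is defined and $Af+(K_\lambda f)B$, computed in $D(A)'$, belongs to $D(A^s)$. **Theorem.** (i) There is a constant $c>0$, and for every $s\in[0,1-\tfrac1{2\alpha})$ a constant $C_s>0$, such that for every $N\in\mathbb N$ there is a non-resonant $\lambda\in[N,N+1]$ for which $A+BK_\lambda$ generates a $C_0$-semigroup on $D(A^s)$ with $$\|e^{t(A+BK_\lambda)}y\|_{D(A^s)}\le C_se^{c\lambda^{1/\alpha}}e^{-\lambda t}\|y\|_{D(A^s)},\qquad y\in D(A^s),\ t\ge 0.$$ If moreover $s>\tfrac1{2\alpha}$,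 then for the same $\lambda$ one has $K_\lambda\in D(A^s)'$ and, for all $f\in D(A^s)$ and $t\ge 0$, $$|K_\lambda f|\le C_se^{c\lambda^{1/\alpha}}\|f\|_{D(A^s)},\qquad |K_\lambda e^{t(A+BK_\lambda)}f|\le C_se^{c\lambda^{1/\alpha}}e^{-\lambda t}\|f\|_{D(A^s)}.$$ Here $c$ does not depend on $s,N,\lambda$, and $C_s$ does not depend on $N,\lambda$. (ii) Let $s\in(\tfrac1{2\alpha},1-\tfrac1{2\alpha})$. For every non-resonant $\lambda>0$, $A+BK_\lambda$ generates a $C_0$-semigroup on $D(A^s)$ and $K_\lambda\in D(A^s)'$; thus $K_\lambda$ is well defined on the trajectories of this semigroup. -/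

import Mathlib

open Filter Topology

noncomputable section

namespace Backstepping

open scoped InnerProductSpace LinearPMap NNReal

/-- A control system `y' = A y + B u` with scalar control on a complex Hilbert space `H`:
`A` is a self-adjoint or skew-adjoint unbounded operator with an orthonormal basis of eigenvectors
`φ n` for nonzero eigenvalues `eig n`, and `B` is an element of `D(A)'`, i.e. a continuous
antilinear functional on `D(A)` with the graph norm (antilinear, so that `H` embeds linearly into
`D(A)'` by `f ↦ ⟪·, f⟫`).  The index set `{1, 2, …}` of the eigenvalues is `ℕ`, shifted by one:
`φ n`, `eig n` stand for the eigenpair number `n + 1`. -/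
structure ControlSystem (H : Type*) [NormedAddCommGroup H] [InnerProductSpace ℂ H]
    [CompleteSpace H] where
  A : H →ₗ.[ℂ] H
  adjoint_eq : A† = A ∨ A† = -A
  φ : HilbertBasis ℕ ℂ H
  eig : ℕ → ℂ
  φ_mem : ∀ n, φ n ∈ A.domain
  A_φ : ∀ n, A ⟨φ n, φ_mem n⟩ = eig n • φ n
  eig_ne_zero : ∀ n, eig n ≠ 0
  B : A.domain →ₗ⋆[ℂ] ℂ
  B_bound : ∃ M : ℝ, ∀ x : A.domain, ‖B x‖ ≤ M * (‖(x : H)‖ + ‖A x‖)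

namespace ControlSystem

variable {H : Type*} [NormedAddCommGroup H] [InnerProductSpace ℂ H] [CompleteSpace H]

/-- The coefficient `bₙ = ⟨B, φₙ⟩`. -/
def b (S : ControlSystem H) (n : ℕ) : ℂ := S.B ⟨S.φ n, S.φ_mem n⟩

/-- The standing assumptions on the spectrum and on the control operator, with growth exponent `α`.
(The resolvent of `A` is then automatically compact and the eigenvalues are simple.) -/
structure Assumptions (S : ControlSystem H) (α : ℝ) : Prop where
  one_lt : 1 < α
  /-- Either `A` is self-adjoint and `0 < -λ₁ ≤ -λ₂ ≤ …`,
  or `A` is skew-adjoint and `0 < -i λ₁ ≤ -i λ₂ ≤ …`. -/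
  sign : (S.A† = S.A ∧
      ∀ n, (S.eig n).im = 0 ∧ 0 < -(S.eig n).re ∧ -(S.eig n).re ≤ -(S.eig (n + 1)).re) ∨
    (S.A† = -S.A ∧
      ∀ n, (S.eig n).re = 0 ∧ 0 < (S.eig n).im ∧ (S.eig n).im ≤ (S.eig (n + 1)).im)
  /-- Controllability and admissibility. -/
  control : ∃ c C : ℝ, 0 < c ∧ ∀ n, c ≤ ‖S.b n‖ ∧ ‖S.b n‖ ≤ C
  /-- Consecutive gaps are of order `n ^ (α - 1)`. -/
  gap_succ : ∃ c C : ℝ, 0 < c ∧ ∀ n : ℕ,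
    c * ((n : ℝ) + 1) ^ (α - 1) ≤ ‖S.eig (n + 1) - S.eig n‖ ∧
      ‖S.eig (n + 1) - S.eig n‖ ≤ C * ((n : ℝ) + 1) ^ (α - 1)
  /-- Lower bound on arbitrary gaps. -/
  gap : ∃ c : ℝ, 0 < c ∧ ∀ k n : ℕ,
    c * ((k : ℝ) + 1) ^ (α - 1) * |(k : ℝ) - (n : ℝ)| ≤ ‖S.eig k - S.eig n‖

/-- The set `𝒩` of resonant values. -/
def resonant (S : ControlSystem H) : Set ℂ := {z | ∃ i j, z = S.eig i - S.eig j}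

/-- The entries of the inverse of the infinite Cauchy matrix `(1 / (λᵢ - λⱼ - lam))ᵢⱼ`. -/
def cauchyInv (S : ControlSystem H) (lam : ℝ) (i j : ℕ) : ℂ :=
  (lam : ℂ) ^ 2 / (S.eig j - S.eig i - lam) *
    (∏' m : {m : ℕ // m ≠ i}, (1 + (lam : ℂ) / (S.eig i - S.eig m))) *
    (∏' n : {n : ℕ // n ≠ j}, (1 - (lam : ℂ) / (S.eig j - S.eig n)))

/-- The feedback coefficients `kₙ = K_lam φₙ`, given by `kₙ bₙ = ∑ⱼ (inverse Cauchy matrix)ₙⱼ`. -/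
def k (S : ControlSystem H) (lam : ℝ) (n : ℕ) : ℂ := (∑' j, S.cauchyInv lam n j) / S.b n

/-- The terms of the series `K_lam f = ∑ₙ kₙ ⟨f, φₙ⟩`. -/
def Kterm (S : ControlSystem H) (lam : ℝ) (f : H) (n : ℕ) : ℂ := S.k lam n * ⟪S.φ n, f⟫_ℂ

lemma Kterm_add (S : ControlSystem H) (lam : ℝ) (f g : H) :
    S.Kterm lam (f + g) = fun n => S.Kterm lam f n + S.Kterm lam g n := by
  funext n; simp [Kterm, mul_add]

lemma Kterm_smul (S : ControlSystem H) (lam : ℝ) (a : ℂ) (f : H) :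
    S.Kterm lam (a • f) = fun n => a * S.Kterm lam f n := by
  funext n; simp only [Kterm, inner_smul_right]; ring

/-- The sequence `(|λₙ| ^ s ⟨f, φₙ⟩)ₙ`, whose `ℓ²` norm is the norm of `D(A^s)`. -/
def weighted (S : ControlSystem H) (s : ℝ) (f : H) (n : ℕ) : ℂ :=
  ((‖S.eig n‖ ^ s : ℝ) : ℂ) * ⟪S.φ n, f⟫_ℂ

lemma norm_weighted_sq (S : ControlSystem H) (s : ℝ) (f : H) (n : ℕ) :
    ‖S.weighted s f n‖ ^ 2 = ‖S.eig n‖ ^ (2 * s) * ‖⟪S.φ n, f⟫_ℂ‖ ^ 2 := by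
  have h : 0 ≤ ‖S.eig n‖ ^ s := Real.rpow_nonneg (norm_nonneg _) _
  rw [weighted, norm_mul, Complex.norm_real, Real.norm_of_nonneg h, mul_pow, mul_comm 2 s,
    Real.rpow_mul (norm_nonneg _), Real.rpow_two]

lemma memℓp_weighted_iff (S : ControlSystem H) (s : ℝ) (f : H) :
    Memℓp (S.weighted s f) 2 ↔
      Summable fun n => ‖S.eig n‖ ^ (2 * s) * ‖⟪S.φ n, f⟫_ℂ‖ ^ 2 := by
  rw [memℓp_gen_iff (by norm_num)]
  simp only [ENNReal.toReal_ofNat, Real.rpow_two, norm_weighted_sq]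

lemma weighted_add (S : ControlSystem H) (s : ℝ) (f g : H) :
    S.weighted s (f + g) = S.weighted s f + S.weighted s g := by
  funext n; simp [weighted, mul_add]

lemma weighted_smul (S : ControlSystem H) (s : ℝ) (a : ℂ) (f : H) :
    S.weighted s (a • f) = a • S.weighted s f := by
  funext n; simp only [weighted, inner_smul_right, Pi.smul_apply, smul_eq_mul]; ring

/-- For `s ≥ 0`, the domain of the fractional power of order `s` of the positive operator `|A|`
(that is `-A` if `A` is self-adjoint), as a subspace of `H`. -/
def domPow (S : ControlSystem H) (s : ℝ) : Submodule ℂ H where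
  carrier := {f | Summable fun n => ‖S.eig n‖ ^ (2 * s) * ‖⟪S.φ n, f⟫_ℂ‖ ^ 2}
  add_mem' {f g} hf hg := by
    simp only [Set.mem_ofPred_eq, ← memℓp_weighted_iff, weighted_add] at *
    exact hf.add hg
  zero_mem' := by simp [summable_zero]
  smul_mem' a f hf := by
    simp only [Set.mem_ofPred_eq, ← memℓp_weighted_iff, weighted_smul] at *
    exact hf.const_smul a

/-- The space `D(A^s)`, `s ≥ 0`, as a type of its own; its norm (below) is not that of `H`. -/
def DPow (S : ControlSystem H) (s : ℝ) : Type _ := S.domPow s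

namespace DPow

variable {S : ControlSystem H} {s : ℝ}

instance : AddCommGroup (S.DPow s) := inferInstanceAs (AddCommGroup (S.domPow s))

instance : Module ℂ (S.DPow s) := inferInstanceAs (Module ℂ (S.domPow s))

/-- The inclusion `D(A^s) ⊆ H`. -/
def incl : S.DPow s →ₗ[ℂ] H := (S.domPow s).subtype

lemma incl_injective : Function.Injective (incl : S.DPow s →ₗ[ℂ] H) :=
  (S.domPow s).injective_subtype

lemma summable (f : S.DPow s) :
    Summable fun n => ‖S.eig n‖ ^ (2 * s) * ‖⟪S.φ n, incl f⟫_ℂ‖ ^ 2 :=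
  Subtype.property f

/-- The map `f ↦ (|λₙ| ^ s ⟨f, φₙ⟩)ₙ` from `D(A^s)` to `ℓ²`. -/
def toLp : S.DPow s →ₗ[ℂ] lp (fun _ : ℕ => ℂ) 2 where
  toFun f := ⟨S.weighted s (incl f), (S.memℓp_weighted_iff s _).2 f.summable⟩
  map_add' f g := by
    apply Subtype.ext
    exact (congrArg (S.weighted s) (map_add incl f g)).trans (S.weighted_add s _ _)
  map_smul' a f := by
    apply Subtype.ext
    exact (congrArg (S.weighted s) (map_smul incl a f)).trans (S.weighted_smul s _ _)

lemma toLp_injective : Function.Injective (toLp : S.DPow s →ₗ[ℂ] _) := by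
  intro f g h
  apply incl_injective
  apply S.φ.repr.injective
  ext n
  have h1 : S.weighted s (incl f) n = S.weighted s (incl g) n :=
    congrFun (congrArg Subtype.val h) n
  have h2 : ((‖S.eig n‖ ^ s : ℝ) : ℂ) ≠ 0 :=
    Complex.ofReal_ne_zero.2 (Real.rpow_pos_of_pos (norm_pos_iff.2 (S.eig_ne_zero n)) s).ne'
  rw [HilbertBasis.repr_apply_apply, HilbertBasis.repr_apply_apply]
  exact mul_left_cancel₀ h2 h1

instance : NormedAddCommGroup (S.DPow s) :=
  NormedAddCommGroup.induced (S.DPow s) (lp (fun _ : ℕ => ℂ) 2) toLp toLp_injective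

instance : NormedSpace ℂ (S.DPow s) :=
  NormedSpace.induced ℂ (S.DPow s) (lp (fun _ : ℕ => ℂ) 2) toLp

/-- The norm of `D(A^s)` is the usual one. -/
lemma norm_sq (f : S.DPow s) :
    ‖f‖ ^ 2 = ∑' n, ‖S.eig n‖ ^ (2 * s) * ‖⟪S.φ n, incl f⟫_ℂ‖ ^ 2 := by
  have h := lp.norm_rpow_eq_tsum (p := 2) (by norm_num) (toLp f)
  simp only [ENNReal.toReal_ofNat, Real.rpow_two] at h
  refine Eq.trans h (tsum_congr fun n => ?_)
  exact S.norm_weighted_sq s (incl f) n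

end DPow

lemma mem_adjoint_domain (S : ControlSystem H) (x : S.A.domain) : (x : H) ∈ S.A†.domain := by
  rcases S.adjoint_eq with h | h
  · rw [h]; exact x.2
  · rw [h]; exact x.2

/-- `A* x` for `x ∈ D(A) = D(A*)`. -/
def adj (S : ControlSystem H) (x : S.A.domain) : H := S.A† ⟨x, S.mem_adjoint_domain x⟩

/-- The graph of the part in `D(A^s)` of the closed-loop operator `A + B K_lam`: the pairs `(f, g)`
of elements of `D(A^s)` such that `K_lam f` is defined and `A f + (K_lam f) B = g` in `D(A)'`, where
the element `A f` of `D(A)'` is `x ↦ ⟪A* x, f⟫`. -/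
def closedLoopGraph (S : ControlSystem H) (lam s : ℝ) : Submodule ℂ (S.DPow s × S.DPow s) where
  carrier := {p | Summable (S.Kterm lam (DPow.incl p.1)) ∧ ∀ x : S.A.domain,
    ⟪S.adj x, DPow.incl p.1⟫_ℂ + (∑' n, S.Kterm lam (DPow.incl p.1) n) * S.B x =
      ⟪(x : H), DPow.incl p.2⟫_ℂ}
  add_mem' {p q} hp hq := by
    refine ⟨?_, fun x => ?_⟩
    · rw [Prod.fst_add, map_add, Kterm_add]
      exact hp.1.add hq.1
    · rw [Prod.fst_add, Prod.snd_add, map_add, map_add, Kterm_add, inner_add_right,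
        inner_add_right, hp.1.tsum_add hq.1, ← hp.2 x, ← hq.2 x]
      ring
  zero_mem' := by
    have h : S.Kterm lam 0 = fun _ => 0 := by funext n; simp [Kterm]
    refine ⟨?_, fun x => ?_⟩
    · rw [Prod.fst_zero, map_zero, h]
      exact summable_zero
    · rw [Prod.fst_zero, Prod.snd_zero, map_zero, h]
      simp
  smul_mem' a p hp := by
    refine ⟨?_, fun x => ?_⟩
    · rw [Prod.smul_fst, map_smul, Kterm_smul]
      exact hp.1.mul_left a
    · rw [Prod.smul_fst, Prod.smul_snd, map_smul, map_smul, Kterm_smul, inner_smul_right,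
        inner_smul_right, tsum_mul_left, ← hp.2 x]
      ring

lemma closedLoopGraph_single_valued (S : ControlSystem H) (lam s : ℝ)
    (p : S.DPow s × S.DPow s) (hp : p ∈ S.closedLoopGraph lam s) (h0 : p.1 = 0) : p.2 = 0 := by
  apply DPow.incl_injective
  apply S.φ.repr.injective
  ext n
  have h := hp.2 ⟨S.φ n, S.φ_mem n⟩
  have hK : S.Kterm lam 0 = fun _ => 0 := by funext n; simp [Kterm]
  rw [h0, map_zero, hK] at h
  rw [HilbertBasis.repr_apply_apply, map_zero, map_zero, ← h]
  simp

/-- The closed-loop operator `A + B K_lam` on `D(A^s)`, with its natural domain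
`{f ∈ D(A^s) : K_lam f is defined and A f + (K_lam f) B ∈ D(A^s)}`. -/
def closedLoop (S : ControlSystem H) (lam s : ℝ) : S.DPow s →ₗ.[ℂ] S.DPow s :=
  (S.closedLoopGraph lam s).toLinearPMap

lemma closedLoop_graph (S : ControlSystem H) (lam s : ℝ) :
    (S.closedLoop lam s).graph = S.closedLoopGraph lam s :=
  Submodule.toLinearPMap_graph_eq _ (S.closedLoopGraph_single_valued lam s)

/-- `L ∈ D(A^s)'` is the feedback functional `K_lam`: the series `∑ₙ kₙ ⟨f, φₙ⟩` converges to
`L f` for all `f ∈ D(A^s)`. -/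
def IsFeedbackOn (S : ControlSystem H) (lam s : ℝ) (L : S.DPow s →L[ℂ] ℂ) : Prop :=
  ∀ f : S.DPow s, HasSum (S.Kterm lam (DPow.incl f)) (L f)

end ControlSystem

/-- A strongly continuous semigroup of bounded operators. -/
structure C0Semigroup (X : Type*) [NormedAddCommGroup X] [NormedSpace ℂ X] where
  toFun : ℝ≥0 → X →L[ℂ] X
  map_zero : toFun 0 = ContinuousLinearMap.id ℂ X
  map_add : ∀ t r, toFun (t + r) = (toFun t).comp (toFun r)
  continuous : ∀ x, Continuous fun t => toFun t x

/-- `G`, with its domain, is the infinitesimal generator of the semigroup `E`. -/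
def C0Semigroup.IsGenerator {X : Type*} [NormedAddCommGroup X] [NormedSpace ℂ X]
    (E : C0Semigroup X) (G : X →ₗ.[ℂ] X) : Prop :=
  ∀ x y : X, (x, y) ∈ G.graph ↔
    Tendsto (fun h : ℝ≥0 => ((h : ℝ) : ℂ)⁻¹ • (E.toFun h x - x)) (𝓝[>] 0) (𝓝 y)

end Backstepping

end

/-! Write `P_n = ∏_{m≠n} (1 + λ/(λ_n - λ_m))`. The feedback is chosen so that the matrix `T_{pn} =
(b_p/b_n) · (-λ P_n)/(λ_p - λ_n - λ)` conjugates `A + BK` to the diagonal operator `A - λ`.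
Multiplying `T_{pn}` by `λ_p - λ_n - λ` leaves `b_p k_n`, because `k_n b_n = -λ P_n` (`k_eq`); this
is the matrix identity `(A - λ)T - TA = BK`. With `TB = B` it becomes `T(A + BK) = (A - λ)T`
(`bsMatrix_intertwine`). The inverse of `T` is the same matrix with `-λ` in place of `λ`.

The algebra is that of Cauchy matrices. Both `TB = B` and `T T⁻¹ = 1` are partial fraction
identities for rational functions with poles at finitely many eigenvalues (`sum_cauchyProd_div`,
`sum_cauchyProd_div_mul`), passed to the limit by dominated convergence (`hasSum_cauchyTprod_div`,
`tsum_cauchyEntry_mul`).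

The analysis has three independent inputs. The gaps grow so fast that the products are at most
`exp(C(1 + λ^{1/α}))`, uniformly in `n` (`GapBound.norm_cauchyTprod_le`). A pigeonhole argument
finds in each `[N, N+1]` a `λ` whose distance to the differences of eigenvalues costs only a power
of `λ` (`GapBound.exists_separated_Icc`). The Schur test with weights `(n+1)^{-1/2}` bounds `T` and
`T⁻¹` on `D(A^s)` exactly in the range `s < 1 - 1/(2α)` allowed by those weights
(`GapBound.exists_schurBound`).

The closed-loop semigroup is then `T⁻¹ e^{t(A-λ)} T`; its generator is identified with the closed
loop, domain included, in `mem_closedLoopGraph_iff_of_bsWeighted`. Since the `k_n` are bounded, `K`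
is continuous on `D(A^s)` as soon as `|λ_n|^{-2s}` is summable, that is `s > 1/(2α)`. -/

namespace Backstepping

/-! ### Partial fractions of finite Cauchy products -/

/-- The finite product `∏_{m ∈ s} (1 + μ / (aₙ - aₘ))`; the factor `m = n` is `1`, as `μ / 0 = 0`. -/
noncomputable def cauchyProd (a : ℕ → ℂ) (μ : ℂ) (s : Finset ℕ) (n : ℕ) : ℂ :=
  ∏ m ∈ s, (1 + μ / (a n - a m))

/-- The infinite product `∏_m (1 + μ / (aₙ - aₘ))` over `m ≠ n`. -/
noncomputable def cauchyTprod (a : ℕ → ℂ) (μ : ℂ) (n : ℕ) : ℂ :=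
  ∏' m, (1 + μ / (a n - a m))

/-- Partial fractions of `f / ∏ (X - v i)`: a polynomial of degree below the number of nodes is its
own Lagrange interpolant, here in barycentric form. -/
lemma sum_nodalWeight_mul_eval {F ι : Type*} [Field F] [DecidableEq ι] {s : Finset ι} {v : ι → F}
    (hv : Set.InjOn v s) {f : Polynomial F} (hf : f.degree < s.card) {x : F}
    (hx : ∀ i ∈ s, x ≠ v i) :
    ∑ i ∈ s, Lagrange.nodalWeight s v i * (x - v i)⁻¹ * f.eval (v i) =
      f.eval x / ∏ i ∈ s, (x - v i) := by
  have h := Lagrange.eval_interpolate_not_at_node (fun i => f.eval (v i)) hx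
  rw [← Lagrange.eq_interpolate hv hf, Lagrange.eval_nodal] at h
  rw [h, mul_div_cancel_left₀]
  exact Finset.prod_ne_zero_iff.2 fun i hi => sub_ne_zero.2 (hx i hi)

/-- Both sides are the residue at `a n` of `∏ (X - a m + μ) / ∏ (X - a m)`; the numerator's factor
`m = n` supplies `μ`. -/
lemma cauchyProd_eq_nodalWeight {a : ℕ → ℂ} (ha : Function.Injective a) (μ : ℂ) {s : Finset ℕ}
    {n : ℕ} (hn : n ∈ s) :
    Lagrange.nodalWeight s a n * ∏ m ∈ s, (a n - (a m - μ)) = μ * cauchyProd a μ s n := by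
  rw [Lagrange.nodalWeight, cauchyProd, ← Finset.mul_prod_erase s _ hn,
    ← Finset.mul_prod_erase s (fun m => 1 + μ / (a n - a m)) hn]
  simp only [sub_self, div_zero, add_zero, one_mul, sub_sub_cancel]
  rw [mul_left_comm, ← Finset.prod_mul_distrib]
  congr 1
  refine Finset.prod_congr rfl fun m hm => ?_
  have : a n - a m ≠ 0 := sub_ne_zero.2 fun h => (Finset.ne_of_mem_erase hm) (ha h).symm
  field_simp
  ring

/-- Partial fractions of `∏ (X - a m + μ) / ∏ (X - a m) - 1`, evaluated at `a p - μ`, where the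
first term vanishes and only `-1` is left. -/
lemma sum_cauchyProd_div {a : ℕ → ℂ} (ha : Function.Injective a) {μ : ℂ} (hμ : μ ≠ 0)
    (hres : ∀ i j, a i - a j ≠ μ) {s : Finset ℕ} {p : ℕ} (hp : p ∈ s) :
    ∑ n ∈ s, cauchyProd a μ s n / (a p - a n - μ) = -1 / μ := by
  have hx : ∀ i ∈ s, a p - μ ≠ a i := fun i _ h => hres p i (by rw [← h]; ring)
  -- Subtracting the second nodal polynomial lowers the degree below `s.card` without changing the
  -- values at the nodes.
  set f := Lagrange.nodal s (fun m => a m - μ) - Lagrange.nodal s a with hf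
  have hdeg : f.degree < s.card := by
    have := Polynomial.degree_sub_lt_left (p := Lagrange.nodal s (fun m => a m - μ))
      (q := Lagrange.nodal s a) (by simp only [Lagrange.degree_nodal])
      Lagrange.nodal_monic.ne_zero
      (by rw [Lagrange.nodal_monic.leadingCoeff, Lagrange.nodal_monic.leadingCoeff])
    rwa [Lagrange.degree_nodal] at this
  have key := sum_nodalWeight_mul_eval (ha.injOn (s := (s : Set ℕ))) hdeg hx
  have hfx : f.eval (a p - μ) = -∏ i ∈ s, (a p - μ - a i) := by
    rw [hf, Polynomial.eval_sub, Lagrange.eval_nodal, Lagrange.eval_nodal,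
      Finset.prod_eq_zero hp (sub_self _), zero_sub]
  have hprod : ∏ i ∈ s, (a p - μ - a i) ≠ 0 :=
    Finset.prod_ne_zero_iff.2 fun i hi => sub_ne_zero.2 (hx i hi)
  rw [hfx, neg_div, div_self hprod] at key
  rw [eq_div_iff hμ, ← key, Finset.sum_mul]
  refine Finset.sum_congr rfl fun n hn => ?_
  have hfn : f.eval (a n) = ∏ m ∈ s, (a n - (a m - μ)) := by
    rw [hf, Polynomial.eval_sub, Lagrange.eval_nodal, Lagrange.eval_nodal,
      Finset.prod_eq_zero (i := n) (f := fun m => a n - a m) hn (sub_self _), sub_zero]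
  rw [hfn, mul_right_comm, cauchyProd_eq_nodalWeight ha μ hn, sub_right_comm]
  ring

/-- Dividing the residue at `a n` by `a n - a p + μ` amounts to deleting the factor `m = p` from the
numerator. At `a q - μ` the shortened numerator vanishes through its factor `m = q`, unless that is
the deleted one. -/
lemma sum_cauchyProd_div_mul {a : ℕ → ℂ} (ha : Function.Injective a) {μ : ℂ} (hμ : μ ≠ 0)
    (hres : ∀ i j, a i - a j ≠ μ) {s : Finset ℕ} {p q : ℕ} (hp : p ∈ s) (hq : q ∈ s) :
    ∑ n ∈ s, -μ * cauchyProd a μ s n / (a q - a n - μ) *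
      (μ * cauchyProd a (-μ) s p / (a n - a p + μ)) = if q = p then 1 else 0 := by
  have hx : ∀ i ∈ s, a q - μ ≠ a i := fun i _ h => hres q i (by rw [← h]; ring)
  have hden : ∀ n, a n - a p + μ ≠ 0 := fun n h => hres p n (by linear_combination -h)
  set f := Lagrange.nodal (s.erase p) (fun m => a m - μ) with hf
  have hdeg : f.degree < s.card := by
    rw [hf, Lagrange.degree_nodal, Nat.cast_lt]
    exact Finset.card_erase_lt_of_mem hp
  have key := sum_nodalWeight_mul_eval (ha.injOn (s := (s : Set ℕ))) hdeg hx
  have hterm : ∀ n ∈ s, -μ * cauchyProd a μ s n / (a q - a n - μ) *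
      (μ * cauchyProd a (-μ) s p / (a n - a p + μ)) = -μ * cauchyProd a (-μ) s p *
      (Lagrange.nodalWeight s a n * (a q - μ - a n)⁻¹ * f.eval (a n)) := by
    intro n hn
    have h1 := cauchyProd_eq_nodalWeight ha μ hn
    rw [← Finset.mul_prod_erase s _ hp] at h1
    rw [hf, Lagrange.eval_nodal]
    have h2 : Lagrange.nodalWeight s a n * ∏ m ∈ s.erase p, (a n - (a m - μ)) =
        μ * cauchyProd a μ s n / (a n - a p + μ) := by
      rw [eq_div_iff (hden n), ← h1]; ring
    rw [mul_right_comm (Lagrange.nodalWeight s a n), h2, sub_right_comm]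
    ring
  rw [Finset.sum_congr rfl hterm, ← Finset.mul_sum, key, hf, Lagrange.eval_nodal]
  split_ifs with h
  · subst h
    have hprod : ∀ i, a q - μ - a i ≠ 0 := fun i hi => hres q i (by linear_combination hi)
    rw [cauchyProd, ← Finset.mul_prod_erase s _ hp,
      ← Finset.mul_prod_erase s (fun i => a q - μ - a i) hp]
    have h3 : (∏ m ∈ s.erase q, (1 + -μ / (a q - a m))) *
        ∏ m ∈ s.erase q, (a q - μ - (a m - μ)) = ∏ m ∈ s.erase q, (a q - μ - a m) := by
      rw [← Finset.prod_mul_distrib]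
      refine Finset.prod_congr rfl fun m hm => ?_
      have : a q - a m ≠ 0 := sub_ne_zero.2 fun h => (Finset.ne_of_mem_erase hm) (ha h).symm
      field_simp
      ring
    have h4 : ∏ m ∈ s.erase q, (a q - μ - a m) ≠ 0 :=
      Finset.prod_ne_zero_iff.2 fun i _ => hprod i
    have h5 : a q - μ - a q = -μ := by ring
    rw [h5, sub_self, div_zero, add_zero, one_mul, mul_div_assoc', mul_assoc, h3,
      div_self (mul_ne_zero (neg_ne_zero.2 hμ) h4)]
  · rw [Finset.prod_eq_zero (i := q) (Finset.mem_erase.2 ⟨h, hq⟩) (by ring), zero_div, mul_zero]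

end Backstepping

namespace Backstepping

/-! ### Bounds for sequences with polynomially growing gaps -/

/-- The gaps of `a` are bounded below as `c * k ^ (α - 1) * |k - n| ≤ ‖aₖ - aₙ‖`, where `α > 1`. -/
structure GapBound (a : ℕ → ℂ) (α c : ℝ) : Prop where
  one_lt : 1 < α
  pos : 0 < c
  le : ∀ k n : ℕ, c * ((k : ℝ) + 1) ^ (α - 1) * |(k : ℝ) - (n : ℝ)| ≤ ‖a k - a n‖

lemma cast_dist_eq_abs_sub (k n : ℕ) : ((Nat.dist k n : ℕ) : ℝ) = |(k : ℝ) - n| := by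
  rcases le_total k n with h | h
  · rw [Nat.dist_eq_sub_of_le h, Nat.cast_sub h, abs_sub_comm, abs_of_nonneg]
    exact sub_nonneg.2 (Nat.cast_le.2 h)
  · rw [Nat.dist_eq_sub_of_le_right h, Nat.cast_sub h, abs_of_nonneg]
    exact sub_nonneg.2 (Nat.cast_le.2 h)

lemma GapBound.injective {a : ℕ → ℂ} {α c : ℝ} (h : GapBound a α c) : Function.Injective a := by
  intro k n hkn
  have h1 := h.le k n
  rw [hkn, sub_self, norm_zero] at h1
  have h2 : 0 < c * ((k : ℝ) + 1) ^ (α - 1) := mul_pos h.pos (Real.rpow_pos_of_pos (by positivity) _)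
  have h3 : |(k : ℝ) - n| ≤ 0 := by
    by_contra h4
    exact absurd h1 (not_le.2 (mul_pos h2 (not_le.1 h4)))
  exact_mod_cast sub_eq_zero.1 (abs_nonpos_iff.1 h3)

/-- The gap bound is used with the larger index in the power, and that index exceeds the distance.
-/
lemma GapBound.dist_rpow_le {a : ℕ → ℂ} {α c : ℝ} (h : GapBound a α c) (k n : ℕ) :
    c * (Nat.dist k n : ℝ) ^ α ≤ ‖a k - a n‖ := by
  wlog hkn : n ≤ k generalizing k n
  · rw [Nat.dist_comm, norm_sub_rev]
    exact this n k (le_of_not_ge hkn)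
  refine le_trans ?_ (h.le k n)
  rw [← cast_dist_eq_abs_sub, mul_assoc]
  refine mul_le_mul_of_nonneg_left ?_ h.pos.le
  rcases eq_or_ne (Nat.dist k n) 0 with h0 | h0
  · rw [h0, Nat.cast_zero, Real.zero_rpow (by linarith [h.one_lt]), mul_zero]
  have h1 : (0 : ℝ) < Nat.dist k n := by exact_mod_cast Nat.pos_of_ne_zero h0
  have h2 : (Nat.dist k n : ℝ) ^ α = (Nat.dist k n : ℝ) ^ (α - 1) * Nat.dist k n := by
    nth_rewrite 3 [← Real.rpow_one (Nat.dist k n : ℝ)]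
    rw [← Real.rpow_add h1, sub_add_cancel]
  rw [h2]
  refine mul_le_mul_of_nonneg_right ?_ h1.le
  refine Real.rpow_le_rpow h1.le ?_ (by linarith [h.one_lt])
  rw [Nat.dist_eq_sub_of_le_right hkn, Nat.cast_sub hkn]
  linarith [(Nat.cast_nonneg n : (0 : ℝ) ≤ n)]

/-- The map `m ↦ |n - m|` is injective on `m < n` and on `m ≥ n`, hence the factor `2`. -/
lemma sum_dist_le {g : ℕ → ℝ} (hg : ∀ d, 0 ≤ g d) (hs : Summable g) (n : ℕ) (s : Finset ℕ) :
    ∑ m ∈ s, g (Nat.dist n m) ≤ 2 * ∑' d, g d := by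
  classical
  have hinj : ∀ t : Finset ℕ, Set.InjOn (Nat.dist n) t →
      ∑ m ∈ t, g (Nat.dist n m) ≤ ∑' d, g d := by
    intro t ht
    rw [← Finset.sum_image (f := g) ht]
    exact hs.sum_le_tsum _ fun d _ => hg d
  rw [← Finset.sum_filter_add_sum_filter_not s (fun m => m < n), two_mul]
  refine add_le_add (hinj _ ?_) (hinj _ ?_)
  · intro x hx y hy hxy
    simp only [Finset.coe_filter, Set.mem_ofPred_eq] at hx hy
    simp only [Nat.dist] at hxy
    omega
  · intro x hx y hy hxy
    simp only [Finset.coe_filter, Set.mem_ofPred_eq] at hx hy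
    simp only [Nat.dist] at hxy
    omega

lemma summable_comp_dist {g : ℕ → ℝ} (hg : ∀ d, 0 ≤ g d) (hs : Summable g) (n : ℕ) :
    Summable fun m => g (Nat.dist n m) :=
  summable_of_sum_le (fun _ => hg _) (sum_dist_le hg hs n)

/-! ### Exponential bound for Cauchy products. -/

/-- Here `R/(d+1) ≥ 1`, so each term is at most `1 + α log (R/(d+1))`, and `R^R / R! ≤ e^R` bounds
the sum of these logarithms by `R`. -/
lemma sum_log_one_add_rpow_le_block_zero {α : ℝ} (hα : 0 ≤ α) (R : ℕ) :
    ∑ d ∈ Finset.range R, Real.log (1 + ((R : ℝ) / ((d : ℝ) + 1)) ^ α) ≤ R * (1 + α) := by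
  have h1 : ∀ d ∈ Finset.range R, Real.log (1 + ((R : ℝ) / ((d : ℝ) + 1)) ^ α) ≤
      1 + α * Real.log ((R : ℝ) / ((d : ℝ) + 1)) := by
    intro d hd
    have hd' : (d : ℝ) + 1 ≤ R := by exact_mod_cast Finset.mem_range.1 hd
    have hpos : (0 : ℝ) < (d : ℝ) + 1 := by positivity
    have hone : 1 ≤ (R : ℝ) / ((d : ℝ) + 1) := (one_le_div hpos).2 hd'
    have h2 : 1 ≤ ((R : ℝ) / ((d : ℝ) + 1)) ^ α := Real.one_le_rpow hone hα
    calc Real.log (1 + ((R : ℝ) / ((d : ℝ) + 1)) ^ α)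
        ≤ Real.log (2 * ((R : ℝ) / ((d : ℝ) + 1)) ^ α) :=
          Real.log_le_log (by positivity) (by linarith)
      _ = Real.log 2 + α * Real.log ((R : ℝ) / ((d : ℝ) + 1)) := by
          rw [Real.log_mul (by norm_num) (by positivity), Real.log_rpow (by positivity)]
      _ ≤ _ := by
          gcongr
          linarith [Real.log_two_lt_d9]
  refine (Finset.sum_le_sum h1).trans ?_
  rw [Finset.sum_add_distrib, ← Finset.mul_sum]
  simp only [Finset.sum_const, Finset.card_range, nsmul_eq_mul, mul_one]
  rcases Nat.eq_zero_or_pos R with h0 | h0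
  · simp [h0]
  have hR : (0 : ℝ) < R := by exact_mod_cast h0
  have h3 : ∑ d ∈ Finset.range R, Real.log ((R : ℝ) / ((d : ℝ) + 1)) ≤ R := by
    rw [← Real.log_prod fun d _ => (div_pos hR (by positivity)).ne', Finset.prod_div_distrib,
      Finset.prod_const, Finset.card_range]
    have h4 : ∏ d ∈ Finset.range R, ((d : ℝ) + 1) = R.factorial := by
      rw [← Finset.prod_range_add_one_eq_factorial]
      push_cast
      rfl
    rw [h4, Real.log_le_iff_le_exp (by positivity)]
    exact Real.pow_div_factorial_le_exp _ hR.le _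
  nlinarith [mul_le_mul_of_nonneg_left h3 hα]

lemma summable_one_div_succ_rpow {p : ℝ} (hp : 1 < p) :
    Summable fun n : ℕ => 1 / ((n : ℝ) + 1) ^ p := by
  have := (summable_nat_add_iff 1).2 (Real.summable_one_div_nat_rpow.2 hp)
  simpa using this

/-- Cutting the range into blocks of length `R`: beyond the first block `log (1 + x) ≤ x` suffices,
and the block starting at `(q+1)R` contributes at most `R/(q+1)^α`. The total is thus linear in `R`.
-/
lemma sum_log_one_add_rpow_le {α : ℝ} (hα : 1 < α) {R : ℕ} (hR : 1 ≤ R) (Q : ℕ) :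
    ∑ d ∈ Finset.range ((Q + 1) * R), Real.log (1 + ((R : ℝ) / ((d : ℝ) + 1)) ^ α) ≤
      R * (1 + α) + R * ∑ q ∈ Finset.range Q, 1 / ((q : ℝ) + 1) ^ α := by
  induction Q with
  | zero => simpa using sum_log_one_add_rpow_le_block_zero (by linarith) R
  | succ Q ih =>
    rw [Nat.succ_mul, Finset.sum_range_add, Finset.sum_range_succ (n := Q), mul_add (R : ℝ) (Finset.sum _ _), ← add_assoc]
    refine add_le_add ih ?_
    have hR' : (0 : ℝ) < R := by exact_mod_cast hR
    have h1 : ∀ d ∈ Finset.range R,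
        Real.log (1 + ((R : ℝ) / ((((Q + 1) * R + d : ℕ) : ℝ) + 1)) ^ α) ≤
          1 / ((Q : ℝ) + 1) ^ α := by
      intro d _
      have h2 : 0 ≤ ((R : ℝ) / ((((Q + 1) * R + d : ℕ) : ℝ) + 1)) ^ α := by positivity
      refine (Real.log_le_sub_one_of_pos (by positivity)).trans ?_
      rw [add_sub_cancel_left, one_div, ← Real.inv_rpow (by positivity)]
      refine Real.rpow_le_rpow (by positivity) ?_ (by linarith)
      rw [div_le_iff₀ (by positivity), inv_mul_eq_div, le_div_iff₀ (by positivity)]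
      push_cast
      nlinarith [(Nat.cast_nonneg d : (0 : ℝ) ≤ d)]
    refine (Finset.sum_le_sum h1).trans ?_
    rw [Finset.sum_const, Finset.card_range, nsmul_eq_mul]

/-- The constant of `tsum_log_one_add_rpow_le`. -/
noncomputable def logSumConst (α : ℝ) : ℝ := 1 + α + ∑' q : ℕ, 1 / ((q : ℝ) + 1) ^ α

lemma logSumConst_pos {α : ℝ} (hα : 1 < α) : 0 < logSumConst α := by
  have : 0 ≤ ∑' q : ℕ, 1 / ((q : ℝ) + 1) ^ α := tsum_nonneg fun q => by positivity
  unfold logSumConst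
  linarith

lemma log_one_add_rpow_nonneg (α : ℝ) (R d : ℕ) : 0 ≤ Real.log (1 + ((R : ℝ) / (d : ℝ)) ^ α) :=
  Real.log_nonneg (by linarith [Real.rpow_nonneg (by positivity : 0 ≤ (R : ℝ) / (d : ℝ)) α])

lemma summable_log_one_add_rpow {α : ℝ} (hα : 1 < α) {R : ℕ} (hR : 1 ≤ R) :
    Summable (fun d : ℕ => Real.log (1 + ((R : ℝ) / (d : ℝ)) ^ α)) ∧
      ∑' d : ℕ, Real.log (1 + ((R : ℝ) / (d : ℝ)) ^ α) ≤ logSumConst α * R := by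
  have hnn := log_one_add_rpow_nonneg α R
  have hb : ∀ n, ∑ d ∈ Finset.range n, Real.log (1 + ((R : ℝ) / ((d + 1 : ℕ) : ℝ)) ^ α) ≤
      logSumConst α * R := by
    intro n
    have h1 : Finset.range n ⊆ Finset.range ((n + 1) * R) :=
      Finset.range_subset_range.2 (by nlinarith)
    refine (Finset.sum_le_sum_of_subset_of_nonneg h1 fun d _ _ => hnn _).trans ?_
    have h2 := sum_log_one_add_rpow_le hα hR n
    have h3 : ∑ q ∈ Finset.range n, 1 / ((q : ℝ) + 1) ^ α ≤ ∑' q : ℕ, 1 / ((q : ℝ) + 1) ^ α :=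
      (summable_one_div_succ_rpow hα).sum_le_tsum _ fun q _ => by positivity
    push_cast
    refine h2.trans ?_
    unfold logSumConst
    nlinarith [mul_le_mul_of_nonneg_left h3 (Nat.cast_nonneg R : (0 : ℝ) ≤ R)]
  have hs1 : Summable fun d : ℕ => Real.log (1 + ((R : ℝ) / ((d + 1 : ℕ) : ℝ)) ^ α) :=
    summable_of_sum_range_le (fun d => hnn _) hb
  have hs : Summable fun d : ℕ => Real.log (1 + ((R : ℝ) / (d : ℝ)) ^ α) :=
    (summable_nat_add_iff 1).1 hs1
  refine ⟨hs, ?_⟩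
  -- The term `d = 0` vanishes, as `R / 0 = 0`; it corresponds to the trivial factor `m = n` of the
  -- product.
  rw [hs.tsum_eq_zero_add, Nat.cast_zero, div_zero, Real.zero_rpow (by linarith), add_zero,
    Real.log_one, zero_add]
  exact Real.tsum_le_of_sum_range_le (fun d => hnn _) hb

/-- With `r = (‖μ‖/c)^{1/α}` the gap bound gives `‖μ/(a n - a m)‖ ≤ (r/|n-m|)^α`, so the logarithm
of the product is at most twice the sum bounded above: of order `r`, not `r^α`. -/
lemma GapBound.prod_one_add_le {a : ℕ → ℂ} {α c : ℝ} (h : GapBound a α c) (μ : ℂ) (n : ℕ)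
    (s : Finset ℕ) :
    ∏ m ∈ s, (1 + ‖μ / (a n - a m)‖) ≤
      Real.exp (2 * logSumConst α * ((‖μ‖ / c) ^ (1 / α) + 2)) := by
  have hα := h.one_lt
  have hc := h.pos
  set r := (‖μ‖ / c) ^ (1 / α) with hr
  have hr0 : 0 ≤ r := by positivity
  -- The extra `1` keeps `R ≥ 1` even when `μ = 0`.
  set R := ⌈r⌉₊ + 1 with hRdef
  have hrR : r ≤ R := (Nat.le_ceil r).trans (by rw [hRdef]; push_cast; linarith)
  have hR2 : (R : ℝ) ≤ r + 2 := by
    rw [hRdef]; push_cast; linarith [Nat.ceil_lt_add_one hr0]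
  obtain ⟨hs, hle⟩ := summable_log_one_add_rpow hα (R := R) (by omega)
  have hnn := log_one_add_rpow_nonneg α R
  have hterm : ∀ m ∈ s, 1 + ‖μ / (a n - a m)‖ ≤
      Real.exp (Real.log (1 + ((R : ℝ) / (Nat.dist n m : ℕ)) ^ α)) := by
    intro m _
    rw [Real.exp_log (by positivity)]
    refine add_le_add le_rfl ?_
    rcases eq_or_ne n m with hnm | hnm
    · subst hnm
      simp only [sub_self, div_zero, norm_zero]
      positivity
    have hd : (0 : ℝ) < Nat.dist n m := by exact_mod_cast Nat.dist_pos_of_ne hnm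
    have hd2 : 0 < c * (Nat.dist n m : ℝ) ^ α := by positivity
    have hμ : ‖μ‖ / c ≤ (R : ℝ) ^ α := by
      have : r ^ α = ‖μ‖ / c := by
        rw [hr, ← Real.rpow_mul (by positivity), one_div, inv_mul_cancel₀ (by linarith),
          Real.rpow_one]
      rw [← this]
      exact Real.rpow_le_rpow hr0 hrR (by linarith)
    rw [norm_div, Real.div_rpow (by positivity) hd.le]
    calc ‖μ‖ / ‖a n - a m‖ ≤ ‖μ‖ / (c * (Nat.dist n m : ℝ) ^ α) := by
          gcongr
          exact h.dist_rpow_le n m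
      _ = ‖μ‖ / c / (Nat.dist n m : ℝ) ^ α := by rw [div_div]
      _ ≤ _ := by gcongr
  refine (Finset.prod_le_prod (fun m _ => by positivity) hterm).trans ?_
  rw [← Real.exp_sum, Real.exp_le_exp]
  refine (sum_dist_le hnn hs n s).trans ?_
  have := mul_le_mul_of_nonneg_left hR2 (logSumConst_pos hα).le
  linarith

lemma GapBound.norm_cauchyProd_le {a : ℕ → ℂ} {α c : ℝ} (h : GapBound a α c) (μ : ℂ)
    (s : Finset ℕ) (n : ℕ) :
    ‖cauchyProd a μ s n‖ ≤ Real.exp (2 * logSumConst α * ((‖μ‖ / c) ^ (1 / α) + 2)) := by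
  refine le_trans ?_ (h.prod_one_add_le μ n s)
  rw [cauchyProd, norm_prod]
  refine Finset.prod_le_prod (fun _ _ => norm_nonneg _) fun m _ => ?_
  exact (norm_add_le _ _).trans (by rw [norm_one])

lemma GapBound.summable_inv_norm {a : ℕ → ℂ} {α c : ℝ} (h : GapBound a α c) (n : ℕ) :
    Summable fun m => 1 / ‖a n - a m‖ := by
  have hα := h.one_lt
  have hc := h.pos
  have hs := (Real.summable_one_div_nat_rpow.2 hα).mul_left (1 / c)
  refine Summable.of_nonneg_of_le (fun m => by positivity) (fun m => ?_)
    (summable_comp_dist (fun d => by positivity) hs n)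
  rcases eq_or_ne n m with hnm | hnm
  · subst hnm
    simp only [sub_self, norm_zero, div_zero]
    positivity
  have hd : (0 : ℝ) < Nat.dist n m := by exact_mod_cast Nat.dist_pos_of_ne hnm
  rw [one_div_mul_one_div]
  exact one_div_le_one_div_of_le (by positivity) (h.dist_rpow_le n m)

lemma GapBound.hasProd_cauchyTprod {a : ℕ → ℂ} {α c : ℝ} (h : GapBound a α c) (μ : ℂ) (n : ℕ) :
    HasProd (fun m => 1 + μ / (a n - a m)) (cauchyTprod a μ n) := by
  refine (multipliable_one_add_of_summable ?_).hasProd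
  refine ((h.summable_inv_norm n).mul_left ‖μ‖).congr fun m => ?_
  rw [norm_div, mul_one_div]

lemma GapBound.tendsto_cauchyProd {a : ℕ → ℂ} {α c : ℝ} (h : GapBound a α c) (μ : ℂ) (n : ℕ) :
    Tendsto (fun N => cauchyProd a μ (Finset.range N) n) atTop (𝓝 (cauchyTprod a μ n)) :=
  (h.hasProd_cauchyTprod μ n).tendsto_prod_nat

lemma GapBound.norm_cauchyTprod_le {a : ℕ → ℂ} {α c : ℝ} (h : GapBound a α c) (μ : ℂ) (n : ℕ) :
    ‖cauchyTprod a μ n‖ ≤ Real.exp (2 * logSumConst α * ((‖μ‖ / c) ^ (1 / α) + 2)) :=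
  le_of_tendsto' (h.tendsto_cauchyProd μ n).norm fun _ => h.norm_cauchyProd_le μ _ n

end Backstepping

namespace Backstepping

/-! ### Infinite Cauchy matrices -/

/-- `μ` keeps a distance from the differences `aₚ - aₙ`, relatively to their size. -/
def Separated (a : ℕ → ℂ) (μ : ℂ) (D : ℝ) : Prop :=
  ∀ p n, ‖a p - a n‖ ≤ D * ‖a p - a n - μ‖

namespace Separated

variable {a : ℕ → ℂ} {μ : ℂ} {D : ℝ}

lemma neg (h : Separated a μ D) : Separated a (-μ) D := fun p n => by
  have := h n p
  rwa [norm_sub_rev, ← norm_neg (a n - a p - μ), show -(a n - a p - μ) = a p - a n - -μ by ring]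
    at this

lemma sub_ne (h : Separated a μ D) (hμ : μ ≠ 0) (i j : ℕ) :
    a i - a j ≠ μ := by
  intro hij
  have h1 := h i j
  rw [hij, sub_self, norm_zero, mul_zero, norm_le_zero_iff] at h1
  exact hμ h1

lemma pos (h : Separated a μ D) (ha : Function.Injective a) : 0 < D := by
  have h1 : 0 < ‖a 0 - a 1‖ := norm_pos_iff.2 (sub_ne_zero.2 fun h => zero_ne_one (ha h))
  by_contra hD
  exact absurd (h1.trans_le (h 0 1))
    (not_lt.2 (mul_nonpos_of_nonpos_of_nonneg (not_lt.1 hD) (norm_nonneg _)))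

lemma one_div_le (h : Separated a μ D) (ha : Function.Injective a) (p n : ℕ) :
    1 / ‖a p - a n - μ‖ ≤ D * (1 / ‖a p - a n‖) + if n = p then 1 / ‖μ‖ else 0 := by
  split_ifs with hnp
  · subst hnp
    simp
  · have h1 : 0 < ‖a p - a n‖ := norm_pos_iff.2 (sub_ne_zero.2 fun h => hnp (ha h).symm)
    have h2 : 0 < ‖a p - a n - μ‖ := by
      refine (norm_nonneg _).lt_of_ne fun h0 => ?_
      have := h p n
      rw [← h0, mul_zero] at this
      linarith
    rw [add_zero, mul_one_div, div_le_div_iff₀ h2 h1, one_mul]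
    exact h p n

lemma summable_one_div (h : Separated a μ D) {α c : ℝ} (hg : GapBound a α c) (p : ℕ) :
    Summable fun n => 1 / ‖a p - a n - μ‖ := by
  refine Summable.of_nonneg_of_le (fun n => by positivity) (h.one_div_le hg.injective p)
    (((hg.summable_inv_norm p).mul_left D).add ?_)
  exact (hasSum_ite_eq p (1 / ‖μ‖)).summable

end Separated

/-- In the finite Cauchy identities both the summands and the range of summation depend on `N`;
extension by zero reduces this to dominated convergence for series. -/
lemma tendsto_sum_range_of_dominated_convergence {F : ℕ → ℕ → ℂ} {G : ℕ → ℂ} {bound : ℕ → ℝ}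
    (hb : Summable bound) (hlim : ∀ n, Tendsto (fun N => F N n) atTop (𝓝 (G n)))
    (hle : ∀ N n, ‖F N n‖ ≤ bound n) :
    Tendsto (fun N => ∑ n ∈ Finset.range N, F N n) atTop (𝓝 (∑' n, G n)) := by
  have h := tendsto_tsum_of_dominated_convergence (𝓕 := atTop)
    (f := fun N n => if n ∈ Finset.range N then F N n else 0) (g := G) hb ?_ ?_
  · refine h.congr fun N => ?_
    rw [tsum_eq_sum (s := Finset.range N) fun n hn => if_neg hn]
    exact Finset.sum_congr rfl fun n hn => if_pos hn
  · intro n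
    refine (hlim n).congr' ?_
    filter_upwards [eventually_gt_atTop n] with N hN
    rw [if_pos (Finset.mem_range.2 hN)]
  · refine Eventually.of_forall fun N n => ?_
    split_ifs
    · exact hle N n
    · rw [norm_zero]; exact (norm_nonneg _).trans (hle N n)

lemma hasSum_cauchyTprod_div {a : ℕ → ℂ} {α c : ℝ} (hg : GapBound a α c) {μ : ℂ} {D : ℝ}
    (h : Separated a μ D) (hμ : μ ≠ 0) (p : ℕ) :
    HasSum (fun n => cauchyTprod a μ n / (a p - a n - μ)) (-1 / μ) := by
  obtain ⟨M, hM⟩ : ∃ M, ∀ s n, ‖cauchyProd a μ s n‖ ≤ M := ⟨_, hg.norm_cauchyProd_le μ⟩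
  have hMT : ∀ n, ‖cauchyTprod a μ n‖ ≤ M := fun n =>
    le_of_tendsto' (hg.tendsto_cauchyProd μ n).norm fun _ => hM _ n
  have hb := (h.summable_one_div hg p).mul_left M
  have hsum : Summable fun n => cauchyTprod a μ n / (a p - a n - μ) := by
    refine Summable.of_norm_bounded hb fun n => ?_
    rw [norm_div, mul_one_div]
    gcongr
    exact hMT n
  have hlim := tendsto_sum_range_of_dominated_convergence hb
    (F := fun N n => cauchyProd a μ (Finset.range N) n / (a p - a n - μ))
    (G := fun n => cauchyTprod a μ n / (a p - a n - μ))
    (fun n => (hg.tendsto_cauchyProd μ n).div_const _) fun N n => by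
      rw [norm_div, mul_one_div]
      gcongr
      exact hM _ n
  have : ∑' n, cauchyTprod a μ n / (a p - a n - μ) = -1 / μ := by
    refine tendsto_nhds_unique hlim (tendsto_const_nhds.congr' ?_)
    -- The finite sums are eventually constant: the identity holds once `p` is in the range.
    filter_upwards [eventually_gt_atTop p] with N hN
    exact (sum_cauchyProd_div hg.injective hμ (h.sub_ne hμ)
      (Finset.mem_range.2 hN)).symm
  rw [← this]
  exact hsum.hasSum

/-- The entry `-μ P_n / (a_p - a_n - μ)`, `P` the Cauchy product, of a matrix conjugate to the
backstepping transformation. -/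
noncomputable def cauchyEntry (a : ℕ → ℂ) (μ : ℂ) (p n : ℕ) : ℂ :=
  -μ * cauchyTprod a μ n / (a p - a n - μ)

/-- After conjugation by the `b n`, this is the normalisation `TB = B`. -/
lemma hasSum_cauchyEntry {a : ℕ → ℂ} {α c : ℝ} (hg : GapBound a α c) {μ : ℂ} {D : ℝ}
    (h : Separated a μ D) (hμ : μ ≠ 0) (p : ℕ) : HasSum (cauchyEntry a μ p) 1 := by
  have := (hasSum_cauchyTprod_div hg h hμ p).mul_left (-μ)
  rw [mul_div_assoc', neg_mul_neg, mul_one, div_self hμ] at this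
  refine this.congr_fun fun n => ?_
  rw [cauchyEntry, mul_div_assoc]

lemma tsum_cauchyEntry_mul {a : ℕ → ℂ} {α c : ℝ} (hg : GapBound a α c) {μ : ℂ} {D : ℝ}
    (h : Separated a μ D) (hμ : μ ≠ 0) (q p : ℕ) :
    ∑' n, cauchyEntry a μ q n * cauchyEntry a (-μ) n p = if q = p then 1 else 0 := by
  obtain ⟨M, hM⟩ : ∃ M, ∀ s n, ‖cauchyProd a μ s n‖ ≤ M := ⟨_, hg.norm_cauchyProd_le μ⟩
  obtain ⟨M', hM'⟩ : ∃ M, ∀ s n, ‖cauchyProd a (-μ) s n‖ ≤ M := ⟨_, hg.norm_cauchyProd_le (-μ)⟩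
  have hM0 : 0 ≤ M := (norm_nonneg _).trans (hM ∅ 0)
  have hM'0 : 0 ≤ M' := (norm_nonneg _).trans (hM' ∅ 0)
  -- A crude uniform bound for the second factor: each term of a nonnegative series is at most its
  -- sum. Summability of the dominating sequence comes from the first factor alone.
  set B := ∑' n, 1 / ‖a p - a n - μ‖ with hB
  have hBle : ∀ n, 1 / ‖a n - a p + μ‖ ≤ B := fun n => by
    have : ‖a n - a p + μ‖ = ‖a p - a n - μ‖ := by
      rw [← norm_neg]; congr 1; ring
    rw [this]
    exact (h.summable_one_div hg p).le_tsum n fun m _ => by positivity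
  have hb := (h.summable_one_div hg q).mul_left (‖μ‖ * M * (‖μ‖ * M' * B))
  have hlim := tendsto_sum_range_of_dominated_convergence hb
    (F := fun N n => -μ * cauchyProd a μ (Finset.range N) n / (a q - a n - μ) *
      (μ * cauchyProd a (-μ) (Finset.range N) p / (a n - a p + μ)))
    (G := fun n => -μ * cauchyTprod a μ n / (a q - a n - μ) *
      (μ * cauchyTprod a (-μ) p / (a n - a p + μ)))
    (fun n => (((hg.tendsto_cauchyProd μ n).const_mul _).div_const _).mul
      (((hg.tendsto_cauchyProd (-μ) p).const_mul _).div_const _)) fun N n => by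
      rw [norm_mul, norm_div, norm_div, norm_mul, norm_mul, norm_neg,
        div_eq_mul_one_div (‖μ‖ * _), div_eq_mul_one_div (‖μ‖ * _)]
      calc ‖μ‖ * ‖cauchyProd a μ (Finset.range N) n‖ * (1 / ‖a q - a n - μ‖) *
            (‖μ‖ * ‖cauchyProd a (-μ) (Finset.range N) p‖ * (1 / ‖a n - a p + μ‖))
          ≤ ‖μ‖ * M * (1 / ‖a q - a n - μ‖) * (‖μ‖ * M' * B) := by
            gcongr
            · exact hM _ n
            · exact hM' _ p
            · exact hBle n
        _ = _ := by ring
  have hlim' : ∑' n, -μ * cauchyTprod a μ n / (a q - a n - μ) *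
      (μ * cauchyTprod a (-μ) p / (a n - a p + μ)) = if q = p then 1 else 0 := by
    refine tendsto_nhds_unique hlim (tendsto_const_nhds.congr' ?_)
    filter_upwards [eventually_gt_atTop p, eventually_gt_atTop q] with N hp hq
    exact (sum_cauchyProd_div_mul hg.injective hμ (h.sub_ne hμ)
      (Finset.mem_range.2 hp) (Finset.mem_range.2 hq)).symm
  rw [← hlim']
  refine tsum_congr fun n => ?_
  rw [cauchyEntry, cauchyEntry, neg_neg, sub_neg_eq_add]

/-! ### Choice of the shift -/

/-- Pigeonhole on `F.card + 1` points of `[N, N+1]` with spacing `1/(F.card + 1)`: one element of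
`F` cannot be closer than half the spacing to two of them. -/
lemma exists_shift_dist_ge (F : Finset ℂ) (N : ℕ) :
    ∃ x : ℝ, (N : ℝ) ≤ x ∧ x ≤ N + 1 ∧ ∀ z ∈ F, 1 / (2 * ((F.card : ℝ) + 1)) ≤ ‖z - x‖ := by
  by_contra! hcon
  set K : ℝ := (F.card : ℝ) + 1 with hK
  have hK0 : 0 < K := by positivity
  let x : ℕ → ℝ := fun i => N + (i + 1 / 2) / K
  have hx : ∀ i ∈ Finset.range (F.card + 1), ∃ z ∈ F, ‖z - x i‖ < 1 / (2 * K) := by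
    intro i hi
    have hi' : (i : ℝ) + 1 ≤ K := by
      rw [hK]; exact_mod_cast Finset.mem_range.1 hi
    have h1 : ((i : ℝ) + 1 / 2) / K ≤ 1 := (div_le_one hK0).2 (by linarith)
    have h2 : 0 ≤ ((i : ℝ) + 1 / 2) / K := by positivity
    exact hcon (x i) (by simp only [x]; linarith) (by simp only [x]; linarith)
  choose! f hfF hf using hx
  obtain ⟨i, hi, j, hj, hij, hfij⟩ :=
    Finset.exists_ne_map_eq_of_card_lt_of_maps_to (t := F) (by simp) hfF
  have h3 : ‖(x i : ℂ) - x j‖ < 1 / K := by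
    have e : (x i : ℂ) - x j = (f j - x j) - (f i - x i) := by rw [hfij]; ring
    rw [e]
    calc _ ≤ ‖f j - x j‖ + ‖f i - x i‖ := norm_sub_le _ _
      _ < 1 / (2 * K) + 1 / (2 * K) := add_lt_add (hf j hj) (hf i hi)
      _ = 1 / K := by field_simp; norm_num
  rw [← Complex.ofReal_sub, Complex.norm_real, Real.norm_eq_abs] at h3
  have h4 : x i - x j = ((i : ℝ) - j) / K := by simp only [x]; ring
  rw [h4, abs_div, abs_of_pos hK0, div_lt_div_iff_of_pos_right hK0, ← cast_dist_eq_abs_sub] at h3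
  have h5 : Nat.dist i j < 1 := by exact_mod_cast h3
  have h6 := Nat.dist_pos_of_ne hij
  omega

/-- As the gaps tend to infinity, only finitely many pairs of distinct indices have a difference of
size at most `r`, and their number is polynomial in `r`. -/
lemma GapBound.lt_of_norm_sub_le {a : ℕ → ℂ} {α c : ℝ} (h : GapBound a α c) {p n : ℕ}
    (hpn : p ≠ n) {r : ℝ} (hr : ‖a p - a n‖ ≤ r) : p < ⌈(r / c) ^ (1 / (α - 1))⌉₊ := by
  have hα : 0 < α - 1 := by linarith [h.one_lt]
  have h1 : (1 : ℝ) ≤ |(p : ℝ) - n| := by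
    rw [← cast_dist_eq_abs_sub]
    exact_mod_cast Nat.dist_pos_of_ne hpn
  have h2 : c * ((p : ℝ) + 1) ^ (α - 1) ≤ r :=
    (le_mul_of_one_le_right (mul_nonneg h.pos.le (by positivity)) h1).trans ((h.le p n).trans hr)
  have h3 : ((p : ℝ) + 1) ^ (α - 1) ≤ r / c := by
    rw [le_div_iff₀ h.pos]; linarith
  have h4 : (p : ℝ) + 1 ≤ (r / c) ^ (1 / (α - 1)) := by
    have := Real.rpow_le_rpow (by positivity) h3 (by positivity : 0 ≤ 1 / (α - 1))
    rwa [← Real.rpow_mul (by positivity), mul_one_div_cancel hα.ne', Real.rpow_one] at this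
  exact Nat.lt_ceil.2 (by linarith)

/-- The finite set of the differences of the first `M` terms of the sequence `a`, and `0`. -/
noncomputable def diffs (a : ℕ → ℂ) (M : ℕ) : Finset ℂ :=
  insert 0 ((Finset.range M ×ˢ Finset.range M).image fun x => a x.1 - a x.2)

lemma card_diffs_le (a : ℕ → ℂ) (M : ℕ) : (diffs a M).card ≤ M ^ 2 + 1 := by
  refine (Finset.card_insert_le _ _).trans (Nat.add_le_add_right (Finset.card_image_le.trans ?_) 1)
  rw [Finset.card_product, Finset.card_range, sq]

lemma GapBound.mem_diffs {a : ℕ → ℂ} {α c : ℝ} (h : GapBound a α c) {p n : ℕ} {r : ℝ}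
    (hr : ‖a p - a n‖ ≤ r) : a p - a n ∈ diffs a ⌈(r / c) ^ (1 / (α - 1))⌉₊ := by
  rcases eq_or_ne p n with rfl | hpn
  · rw [sub_self]; exact Finset.mem_insert_self _ _
  · refine Finset.mem_insert_of_mem (Finset.mem_image.2 ⟨(p, n), ?_, rfl⟩)
    exact Finset.mem_product.2 ⟨Finset.mem_range.2 (h.lt_of_norm_sub_le hpn hr),
      Finset.mem_range.2 (h.lt_of_norm_sub_le hpn.symm (by rwa [norm_sub_rev]))⟩

/-- Differences larger than `2 * x` are separated from `x` by the triangle inequality, with constant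
`2`; the others cost `2 * x / δ`. -/
lemma separated_of_le {a : ℕ → ℂ} {x δ : ℝ} (hx : 0 < x) (hδ : 0 < δ)
    (h : ∀ p n, ‖a p - a n‖ ≤ 2 * x → δ ≤ ‖a p - a n - x‖) :
    Separated a x (2 + 2 * x / δ) := by
  intro p n
  have h0 : 0 ≤ ‖a p - a n - x‖ := norm_nonneg _
  rcases le_or_gt ‖a p - a n‖ (2 * x) with h1 | h1
  · have h2 : 2 * x ≤ 2 * x / δ * ‖a p - a n - x‖ := by
      rw [div_mul_eq_mul_div, le_div_iff₀ hδ]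
      exact mul_le_mul_of_nonneg_left (h p n h1) (by positivity)
    rw [add_mul]
    linarith
  · have h2 : ‖a p - a n‖ - ‖(x : ℂ)‖ ≤ ‖a p - a n - x‖ := norm_sub_norm_le _ _
    rw [Complex.norm_real, Real.norm_of_nonneg hx.le] at h2
    have h3 : 0 ≤ 2 * x / δ * ‖a p - a n - x‖ := by positivity
    rw [add_mul]
    linarith

lemma GapBound.exists_separated {a : ℕ → ℂ} {α c : ℝ} (h : GapBound a α c) {x : ℝ} (hx : 0 < x)
    (hres : ∀ i j, (x : ℂ) ≠ a i - a j) : ∃ D, Separated a x D := by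
  set F := diffs a ⌈(2 * x / c) ^ (1 / (α - 1))⌉₊ with hF
  obtain ⟨z, hz, hmin⟩ := F.exists_min_image (fun z => ‖z - x‖) ⟨0, Finset.mem_insert_self _ _⟩
  have hzx : 0 < ‖z - x‖ := by
    refine norm_pos_iff.2 (sub_ne_zero.2 ?_)
    rcases Finset.mem_insert.1 hz with h0 | h1
    · rw [h0]; exact_mod_cast hx.ne
    · obtain ⟨y, -, rfl⟩ := Finset.mem_image.1 h1
      exact (hres _ _).symm
  exact ⟨_, separated_of_le hx hzx fun p n hpn => hmin _ (h.mem_diffs hpn)⟩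

/-- Lets powers of `λ` be absorbed into `exp (λ^{1/α})`: with `y = x^{1/α}`, `1 + x ≤ (1 + y)^α`,
and powers of `1 + y` are dominated by the exponential series. -/
lemma exists_one_add_rpow_le_exp {α : ℝ} (hα : 1 ≤ α) (r : ℝ) :
    ∃ C : ℝ, 0 < C ∧ ∀ x : ℝ, 0 ≤ x → (1 + x) ^ r ≤ C * Real.exp (x ^ (1 / α)) := by
  set k := ⌈α * r⌉₊ with hk
  refine ⟨k.factorial * Real.exp 1, by positivity, fun x hx => ?_⟩
  set y := x ^ (1 / α) with hy
  have hy0 : 0 ≤ y := by positivity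
  have hxy : y ^ α = x := by
    rw [hy, ← Real.rpow_mul hx, one_div, inv_mul_cancel₀ (by linarith), Real.rpow_one]
  rcases le_or_gt r 0 with hr | hr
  · refine (Real.rpow_le_one_of_one_le_of_nonpos (by linarith) hr).trans ?_
    have h1 : (1 : ℝ) ≤ k.factorial := by exact_mod_cast Nat.factorial_pos k
    have h2 : 1 ≤ Real.exp 1 := Real.one_le_exp zero_le_one
    have h3 : 1 ≤ Real.exp y := Real.one_le_exp hy0
    exact one_le_mul_of_one_le_of_one_le (one_le_mul_of_one_le_of_one_le h1 h2) h3
  have h1 : 1 + x ≤ (1 + y) ^ α := by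
    have := Real.add_rpow_le_rpow_add zero_le_one hy0 hα
    rwa [Real.one_rpow, hxy] at this
  calc (1 + x) ^ r ≤ ((1 + y) ^ α) ^ r := Real.rpow_le_rpow (by linarith) h1 hr.le
    _ = (1 + y) ^ (α * r) := by rw [← Real.rpow_mul (by linarith)]
    _ ≤ (1 + y) ^ (k : ℝ) := Real.rpow_le_rpow_of_exponent_le (by linarith) (Nat.le_ceil _)
    _ = (1 + y) ^ k := Real.rpow_natCast _ _
    _ ≤ k.factorial * Real.exp (1 + y) := by
      have := Real.pow_div_factorial_le_exp (1 + y) (by linarith) k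
      rw [div_le_iff₀ (by positivity)] at this
      linarith
    _ = _ := by rw [Real.exp_add]; ring

/-- The differences that matter number at most about `(1 + x)^{2/(α-1)}`, so pigeonhole leaves a
distance at worst polynomially small. -/
lemma GapBound.exists_separated_Icc {a : ℕ → ℂ} {α c : ℝ} (h : GapBound a α c) :
    ∃ C : ℝ, 0 < C ∧ ∀ N : ℕ, ∃ x D : ℝ, (N : ℝ) ≤ x ∧ x ≤ N + 1 ∧ 0 < x ∧
      Separated a x D ∧ 1 + x * D ≤ C * Real.exp (x ^ (1 / α)) := by
  have hα : 0 < α - 1 := by linarith [h.one_lt]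
  have hc := h.pos
  set β := 1 / (α - 1) with hβ
  have hβ0 : 0 < β := by positivity
  set B := (4 / c) ^ β + 1 with hB
  have hB0 : 0 < B := by positivity
  -- `β * 2` counts pairs of indices below `M`; the other `2` is the factor `x ^ 2` in `x * (2 * x /
  -- δ)`.
  obtain ⟨C, hC, hCle⟩ := exists_one_add_rpow_le_exp h.one_lt.le (β * 2 + 2)
  refine ⟨(1 + 4 * (B ^ 2 + 2)) * C, by positivity, fun N => ?_⟩
  set M := ⌈(2 * ((N : ℝ) + 1) / c) ^ β⌉₊ with hM
  set F := diffs a M with hF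
  obtain ⟨x, hNx, hxN, hxF⟩ := exists_shift_dist_ge F N
  have hδ : 0 < 1 / (2 * ((F.card : ℝ) + 1)) := by positivity
  have hN0 : (0 : ℝ) ≤ N := Nat.cast_nonneg N
  -- For `N = 0` positivity comes from `0` being one of the avoided points.
  have hx : 0 < x := by
    have h0 := hxF 0 (Finset.mem_insert_self _ _)
    rw [zero_sub, norm_neg, Complex.norm_real, Real.norm_of_nonneg (by linarith)] at h0
    linarith
  refine ⟨x, _, hNx, hxN, hx, separated_of_le hx hδ fun p n hpn => hxF _ ?_, ?_⟩
  · exact h.mem_diffs (hpn.trans (by linarith))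
  set u := (1 + x) ^ β with hu
  have hu1 : 1 ≤ u := Real.one_le_rpow (by linarith) hβ0.le
  have hMle : (M : ℝ) ≤ B * u := by
    have h1 : (2 * ((N : ℝ) + 1) / c) ^ β ≤ (4 / c) ^ β * u := by
      rw [hu, ← Real.mul_rpow (by positivity) (by positivity)]
      refine Real.rpow_le_rpow (by positivity) ?_ hβ0.le
      rw [div_mul_eq_mul_div]
      exact div_le_div_of_nonneg_right (by linarith) hc.le
    have h2 := (Nat.ceil_lt_add_one
      (by positivity : 0 ≤ (2 * ((N : ℝ) + 1) / c) ^ β)).le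
    calc (M : ℝ) ≤ (4 / c) ^ β * u + 1 := h2.trans (by linarith)
      _ ≤ B * u := by rw [hB]; linarith
  have hcard : (F.card : ℝ) + 1 ≤ (B ^ 2 + 2) * u ^ 2 := by
    have h1 : (F.card : ℝ) ≤ (M : ℝ) ^ 2 + 1 := by exact_mod_cast card_diffs_le a M
    have h2 : (M : ℝ) ^ 2 ≤ (B * u) ^ 2 := by gcongr
    nlinarith
  have hfin : 1 + x * (2 + 2 * x / (1 / (2 * ((F.card : ℝ) + 1)))) ≤
      (1 + 4 * (B ^ 2 + 2)) * (u ^ 2 * (1 + x) ^ 2) := by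
    have e : 1 + x * (2 + 2 * x / (1 / (2 * ((F.card : ℝ) + 1)))) =
        1 + 2 * x + 4 * x ^ 2 * ((F.card : ℝ) + 1) := by field_simp; ring
    rw [e]
    have hu2 : 1 ≤ u ^ 2 := one_le_pow₀ hu1
    have h1 : 1 + 2 * x ≤ u ^ 2 * (1 + x) ^ 2 := by nlinarith [sq_nonneg x]
    have h2 : 4 * x ^ 2 * ((F.card : ℝ) + 1) ≤ 4 * (1 + x) ^ 2 * ((B ^ 2 + 2) * u ^ 2) := by
      gcongr
      linarith
    linarith
  refine hfin.trans ?_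
  have e2 : u ^ 2 * (1 + x) ^ 2 = (1 + x) ^ (β * 2 + 2) := by
    rw [Real.rpow_add (by linarith), Real.rpow_mul (by linarith), Real.rpow_two, Real.rpow_two]
  rw [e2, mul_assoc]
  exact mul_le_mul_of_nonneg_left (hCle x hx.le) (by positivity)

end Backstepping

namespace Backstepping

/-! ### Matrices acting on `ℓ²` -/

/-- The Hilbert space of square summable complex sequences. -/
abbrev Ell2 : Type := lp (fun _ : ℕ => ℂ) 2

lemma ell2_sum_sq_le (f : Ell2) (s : Finset ℕ) : ∑ n ∈ s, ‖f n‖ ^ 2 ≤ ‖f‖ ^ 2 := by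
  have h := lp.sum_rpow_le_norm_rpow (p := 2) (by norm_num) f s
  simpa only [ENNReal.toReal_ofNat, Real.rpow_two] using h

lemma ell2_summable_sq (f : Ell2) : Summable fun n => ‖f n‖ ^ 2 :=
  summable_of_sum_le (fun _ => by positivity) (ell2_sum_sq_le f)

lemma ell2_norm_le {f : Ell2} {C : ℝ} (hC : 0 ≤ C)
    (h : ∀ s : Finset ℕ, ∑ n ∈ s, ‖f n‖ ^ 2 ≤ C ^ 2) : ‖f‖ ≤ C := by
  refine lp.norm_le_of_forall_sum_le (p := 2) (by norm_num) hC fun s => ?_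
  simpa only [ENNReal.toReal_ofNat, Real.rpow_two] using h s

lemma memℓp_two_of_sum_le {f : ℕ → ℂ} {C : ℝ} (h : ∀ s : Finset ℕ, ∑ n ∈ s, ‖f n‖ ^ 2 ≤ C) :
    Memℓp f 2 := by
  refine memℓp_gen' (C := C) fun s => ?_
  simpa only [ENNReal.toReal_ofNat, Real.rpow_two] using h s

lemma memℓp_two_of_norm_le {f g : ℕ → ℂ} (hg : Memℓp g 2) (C : ℝ) (h : ∀ n, ‖f n‖ ≤ C * ‖g n‖) :
    Memℓp f 2 := by
  refine memℓp_two_of_sum_le (C := C ^ 2 * ‖(⟨g, hg⟩ : Ell2)‖ ^ 2) fun s => ?_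
  calc ∑ n ∈ s, ‖f n‖ ^ 2 ≤ ∑ n ∈ s, C ^ 2 * ‖g n‖ ^ 2 := by
        refine Finset.sum_le_sum fun n _ => ?_
        rw [← mul_pow]
        exact pow_le_pow_left₀ (norm_nonneg _) (h n) 2
    _ = C ^ 2 * ∑ n ∈ s, ‖g n‖ ^ 2 := by rw [Finset.mul_sum]
    _ ≤ _ := mul_le_mul_of_nonneg_left (ell2_sum_sq_le ⟨g, hg⟩ s) (sq_nonneg C)

/-- The hypotheses of the Schur test, with weights `w`, for a kernel `κ`. -/
structure SchurBound (κ : ℕ → ℕ → ℝ) (w : ℕ → ℝ) (A : ℝ) : Prop where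
  nonneg : ∀ p n, 0 ≤ κ p n
  pos : ∀ n, 0 < w n
  row : ∀ p (s : Finset ℕ), ∑ n ∈ s, κ p n * w n ≤ A * w p
  col : ∀ n (s : Finset ℕ), ∑ p ∈ s, κ p n * w p ≤ A * w n

namespace SchurBound

variable {κ : ℕ → ℕ → ℝ} {w : ℕ → ℝ} {A : ℝ}

lemma const_nonneg (h : SchurBound κ w A) : 0 ≤ A :=
  nonneg_of_mul_nonneg_left ((Finset.sum_empty).symm.trans_le (h.row 0 ∅)) (h.pos 0)

/-- Cauchy–Schwarz for the splitting `κ f = √(κ w) · √(κ / w) f`; the row bound controls the first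
factor, the column bound the second after exchanging sums. -/
lemma sum_sq_le (h : SchurBound κ w A) (f : ℕ → ℝ) (s t : Finset ℕ) :
    ∑ p ∈ s, (∑ n ∈ t, κ p n * f n) ^ 2 ≤ A ^ 2 * ∑ n ∈ t, f n ^ 2 := by
  have hA := h.const_nonneg
  have h1 : ∀ p ∈ s, (∑ n ∈ t, κ p n * f n) ^ 2 ≤
      A * ∑ n ∈ t, κ p n * w p * (f n ^ 2 / w n) := by
    intro p _
    have hq : ∀ n ∈ t, 0 ≤ κ p n * (f n ^ 2 / w n) := fun n _ =>
      mul_nonneg (h.nonneg p n) (div_nonneg (sq_nonneg _) (h.pos n).le)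
    refine (Finset.sum_sq_le_sum_mul_sum_of_sq_le_mul t (f := fun n => κ p n * w n)
      (g := fun n => κ p n * (f n ^ 2 / w n))
      (fun n _ => mul_nonneg (h.nonneg p n) (h.pos n).le) hq fun n _ => ?_).trans ?_
    · refine le_of_eq ?_
      have := (h.pos n).ne'
      field_simp
    · refine (mul_le_mul_of_nonneg_right (h.row p t) (Finset.sum_nonneg hq)).trans_eq ?_
      rw [mul_assoc, Finset.mul_sum]
      congr 1
      refine Finset.sum_congr rfl fun n _ => ?_
      ring
  refine (Finset.sum_le_sum h1).trans ?_
  rw [← Finset.mul_sum, Finset.sum_comm, sq, mul_assoc]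
  refine mul_le_mul_of_nonneg_left ?_ hA
  rw [Finset.mul_sum]
  refine Finset.sum_le_sum fun n _ => ?_
  rw [← Finset.sum_mul]
  have := h.pos n
  calc (∑ p ∈ s, κ p n * w p) * (f n ^ 2 / w n) ≤ A * w n * (f n ^ 2 / w n) :=
        mul_le_mul_of_nonneg_right (h.col n s) (by positivity)
    _ = A * f n ^ 2 := by field_simp

variable {M : ℕ → ℕ → ℂ}

lemma sum_sq_norm_le (h : SchurBound κ w A) (hM : ∀ p n, ‖M p n‖ ≤ κ p n) (f : Ell2)
    (s t : Finset ℕ) : ∑ p ∈ s, (∑ n ∈ t, ‖M p n * f n‖) ^ 2 ≤ (A * ‖f‖) ^ 2 := by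
  have h1 := h.sum_sq_le (fun n => ‖f n‖) s t
  have h2 := mul_le_mul_of_nonneg_left (ell2_sum_sq_le f t) (sq_nonneg A)
  rw [mul_pow]
  refine le_trans ?_ (h1.trans h2)
  gcongr with p _ n _
  rw [norm_mul]
  exact mul_le_mul_of_nonneg_right (hM p n) (norm_nonneg _)

lemma summable (h : SchurBound κ w A) (hM : ∀ p n, ‖M p n‖ ≤ κ p n) (f : Ell2) (p : ℕ) :
    Summable fun n => ‖M p n * f n‖ := by
  refine summable_of_sum_le (c := A * ‖f‖) (fun _ => norm_nonneg _) fun t => ?_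
  have h1 := h.sum_sq_norm_le hM f {p} t
  rw [Finset.sum_singleton] at h1
  exact le_of_sq_le_sq h1 (mul_nonneg h.const_nonneg (norm_nonneg _))

lemma sum_sq_tsum_le (h : SchurBound κ w A) (hM : ∀ p n, ‖M p n‖ ≤ κ p n) (f : Ell2)
    (s : Finset ℕ) : ∑ p ∈ s, ‖∑' n, M p n * f n‖ ^ 2 ≤ (A * ‖f‖) ^ 2 := by
  have hlim : Tendsto (fun t : Finset ℕ => ∑ p ∈ s, (∑ n ∈ t, ‖M p n * f n‖) ^ 2) atTop
      (𝓝 (∑ p ∈ s, (∑' n, ‖M p n * f n‖) ^ 2)) :=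
    tendsto_finsetSum _ fun p _ => (h.summable hM f p).hasSum.pow 2
  refine le_trans ?_ (le_of_tendsto' hlim fun t => h.sum_sq_norm_le hM f s t)
  gcongr with p _
  exact norm_tsum_le_tsum_norm (h.summable hM f p)

/-- The Schur test. -/
theorem exists_continuousLinearMap (h : SchurBound κ w A) (hM : ∀ p n, ‖M p n‖ ≤ κ p n) :
    ∃ T : Ell2 →L[ℂ] Ell2, ‖T‖ ≤ A ∧ ∀ f p, HasSum (fun n => M p n * f n) (T f p) := by
  have hs : ∀ (f : Ell2) p, Summable fun n => M p n * f n := fun f p => (h.summable hM f p).of_norm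
  let T : Ell2 →ₗ[ℂ] Ell2 :=
    { toFun := fun f => ⟨fun p => ∑' n, M p n * f n, memℓp_two_of_sum_le (h.sum_sq_tsum_le hM f)⟩
      map_add' := fun f g => by
        ext p
        change ∑' n, M p n * (f n + g n) = ∑' n, M p n * f n + ∑' n, M p n * g n
        rw [← (hs f p).tsum_add (hs g p)]
        exact tsum_congr fun n => mul_add _ _ _
      map_smul' := fun c f => by
        ext p
        change ∑' n, M p n * (c * f n) = c * ∑' n, M p n * f n
        rw [← tsum_mul_left]
        exact tsum_congr fun n => mul_left_comm _ _ _ }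
  have hT : ∀ f, ‖T f‖ ≤ A * ‖f‖ := fun f =>
    ell2_norm_le (mul_nonneg h.const_nonneg (norm_nonneg _)) (h.sum_sq_tsum_le hM f)
  exact ⟨T.mkContinuous A hT, T.mkContinuous_norm_le h.const_nonneg hT,
    fun f p => (hs f p).hasSum⟩

end SchurBound

lemma matrix_apply_single {M : ℕ → ℕ → ℂ} {T : Ell2 →L[ℂ] Ell2}
    (hT : ∀ f p, HasSum (fun n => M p n * f n) (T f p)) (q : ℕ) (c : ℂ) (p : ℕ) :
    T (lp.single 2 q c) p = M p q * c := by
  have h1 := hT (lp.single 2 q c) p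
  have h2 := hasSum_single (f := fun n => M p n * (lp.single 2 q c : Ell2) n) q fun n hn =>
    mul_eq_zero_of_right _ (lp.single_apply_ne (E := fun _ : ℕ => ℂ) 2 q c hn)
  exact (h1.unique h2).trans
    (congrArg (M p q * ·) (lp.single_apply_self (E := fun _ : ℕ => ℂ) 2 q c))

/-- Checked on the coordinate vectors and extended by continuity, so no double series has to be
rearranged. -/
lemma matrix_comp_eq_id {M M' : ℕ → ℕ → ℂ} {T T' : Ell2 →L[ℂ] Ell2}
    (hT : ∀ f p, HasSum (fun n => M p n * f n) (T f p))
    (hT' : ∀ f p, HasSum (fun n => M' p n * f n) (T' f p))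
    (hM : ∀ q p, ∑' n, M q n * M' n p = if q = p then 1 else 0) (f : Ell2) : T (T' f) = f := by
  have h1 : ∀ p (c : ℂ), T (T' (lp.single 2 p c)) = lp.single 2 p c := by
    intro p c
    ext q
    rw [← (hT _ q).tsum_eq]
    simp only [matrix_apply_single hT', ← mul_assoc]
    rw [tsum_mul_right, hM, lp.single_apply]
    split_ifs with h
    · rw [h, Pi.single_eq_same, one_mul]
    · rw [Pi.single_eq_of_ne h, zero_mul]
  have h2 := lp.hasSum_single (p := 2) ENNReal.ofNat_ne_top f
  have h3 := (h2.mapL T').mapL T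
  simp only [h1] at h3
  exact h3.unique h2

/-! ### The Schur test for Cauchy matrices -/

lemma rpow_ratio_le_of_lt {α β δ P N : ℝ} (hN : 1 ≤ N) (hNP : N + 1 ≤ P) (h1 : 1 ≤ β)
    (hδ : δ ≤ α - β) (hδ0 : 0 < δ) :
    (P / N) ^ β / (P ^ (α - 1) * (P - N)) ≤ 1 / N ^ (1 + δ) + 1 / (P - N) ^ (1 + δ) := by
  have hP : 0 < P := by linarith
  have hN0 : 0 < N := by linarith
  have hd : 0 < P - N := by linarith
  -- From `P / (N (P - N)) = 1/N + 1/(P - N)`.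
  have e : (P / N) ^ β / (P ^ (α - 1) * (P - N)) =
      P ^ (β - α) * N ^ (1 - β) * (1 / N + 1 / (P - N)) := by
    rw [Real.div_rpow hP.le hN0.le, Real.rpow_sub hP, Real.rpow_sub hN0, Real.rpow_sub hP,
      Real.rpow_one, Real.rpow_one]
    have := (Real.rpow_pos_of_pos hP α).ne'
    have := (Real.rpow_pos_of_pos hP β).ne'
    have := (Real.rpow_pos_of_pos hN0 β).ne'
    field_simp
    ring
  have h2 : N ^ (1 - β) ≤ 1 := Real.rpow_le_one_of_one_le_of_nonpos hN (by linarith)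
  have h3 : ∀ x, 1 ≤ x → x ≤ P → P ^ (β - α) * (1 / x) ≤ 1 / x ^ (1 + δ) := by
    intro x hx hxP
    have hx0 : 0 < x := by linarith
    have h4 : P ^ (β - α) ≤ x ^ (-δ) :=
      (Real.rpow_le_rpow_of_exponent_le (by linarith) (by linarith)).trans
        (Real.rpow_le_rpow_of_nonpos hx0 hxP (by linarith))
    calc P ^ (β - α) * (1 / x) ≤ x ^ (-δ) * (1 / x) := by gcongr
      _ = _ := by
        rw [Real.rpow_add hx0, Real.rpow_one, Real.rpow_neg hx0.le]
        have := (Real.rpow_pos_of_pos hx0 δ).ne'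
        field_simp
  rw [e]
  calc P ^ (β - α) * N ^ (1 - β) * (1 / N + 1 / (P - N))
      ≤ P ^ (β - α) * 1 * (1 / N + 1 / (P - N)) := by gcongr
    _ = P ^ (β - α) * (1 / N) + P ^ (β - α) * (1 / (P - N)) := by ring
    _ ≤ _ := add_le_add (h3 N hN (by linarith)) (h3 (P - N) (by linarith) (by linarith))

lemma rpow_ratio_le_of_gt {α γ δ P N : ℝ} (hP : 1 ≤ P) (hPN : P + 1 ≤ N) (h0 : 0 ≤ γ)
    (hδ : δ ≤ α - 1 - γ) (hδ0 : 0 < δ) :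
    (N / P) ^ γ / (N ^ (α - 1) * (N - P)) ≤ 1 / (N - P) ^ (1 + δ) := by
  have hN : 0 < N := by linarith
  have hP0 : 0 < P := by linarith
  have hd : 0 < N - P := by linarith
  have h1 : (N / P) ^ γ ≤ N ^ γ :=
    Real.rpow_le_rpow (by positivity) (div_le_self hN.le hP) h0
  have h2 : N ^ (γ - (α - 1)) ≤ (N - P) ^ (-δ) :=
    (Real.rpow_le_rpow_of_exponent_le (by linarith) (by linarith)).trans
      (Real.rpow_le_rpow_of_nonpos hd (by linarith) (by linarith))
  calc (N / P) ^ γ / (N ^ (α - 1) * (N - P)) ≤ N ^ γ / (N ^ (α - 1) * (N - P)) := by gcongr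
    _ = N ^ (γ - (α - 1)) * (1 / (N - P)) := by
      rw [Real.rpow_sub hN γ]
      field_simp
    _ ≤ (N - P) ^ (-δ) * (1 / (N - P)) := by gcongr
    _ = _ := by
      rw [Real.rpow_add hd, Real.rpow_one, Real.rpow_neg hd.le]
      have := (Real.rpow_pos_of_pos hd δ).ne'
      field_simp

/-- Each term is dominated by summable powers of `n + 1` and of `|p - n|`. The upper limit on `β` is
needed for `n < p`, the lower one for `n > p`. -/
lemma GapBound.exists_sum_ratio_le {a : ℕ → ℂ} {α c : ℝ} (h : GapBound a α c) {β : ℝ}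
    (hβ : 1 - α < β) (hβ' : β < α) :
    ∃ A : ℝ, 0 < A ∧ ∀ (p : ℕ) (s : Finset ℕ),
      ∑ n ∈ s, (((p : ℝ) + 1) / ((n : ℝ) + 1)) ^ β / ‖a p - a n‖ ≤ A := by
  have hα := h.one_lt
  have hc := h.pos
  -- Raising the exponent only enlarges a ratio that is at least `1`, so `β' ≥ 1` may be assumed for
  -- `n < p` and `γ ≥ 0` for `n > p`; `δ` is the decay left over.
  set β' := max β 1 with hβ'def
  set γ := max (-β) 0 with hγ
  set δ := min (α - β') (α - 1 - γ) with hδ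
  have hδ0 : 0 < δ := by
    rw [hδ, lt_min_iff, hβ'def, hγ]
    constructor
    · rw [sub_pos]; exact max_lt hβ' hα
    · rw [sub_pos]; exact max_lt (by linarith) (by linarith)
  have hδ1 : δ ≤ α - β' := min_le_left _ _
  have hδ2 : δ ≤ α - 1 - γ := min_le_right _ _
  have hs : Summable fun n : ℕ => 1 / ((n : ℝ) + 1) ^ (1 + δ) :=
    summable_one_div_succ_rpow (by linarith)
  have hs' : Summable fun n : ℕ => 1 / (n : ℝ) ^ (1 + δ) :=
    Real.summable_one_div_nat_rpow.2 (by linarith)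
  set Z := ∑' n : ℕ, 1 / ((n : ℝ) + 1) ^ (1 + δ)
  set Z' := ∑' n : ℕ, 1 / (n : ℝ) ^ (1 + δ)
  have hZ : 0 ≤ Z := tsum_nonneg fun n => by positivity
  have hZ' : 0 ≤ Z' := tsum_nonneg fun n => by positivity
  refine ⟨1 / c * (Z + 2 * Z') + 1, by positivity, fun p s => ?_⟩
  have hterm : ∀ n ∈ s, (((p : ℝ) + 1) / ((n : ℝ) + 1)) ^ β / ‖a p - a n‖ ≤
      1 / c * (1 / ((n : ℝ) + 1) ^ (1 + δ) + 1 / (Nat.dist p n : ℝ) ^ (1 + δ)) := by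
    intro n _
    have hp1 : (1 : ℝ) ≤ (p : ℝ) + 1 := by linarith [(Nat.cast_nonneg p : (0 : ℝ) ≤ p)]
    have hn1 : (1 : ℝ) ≤ (n : ℝ) + 1 := by linarith [(Nat.cast_nonneg n : (0 : ℝ) ≤ n)]
    rcases lt_trichotomy n p with hnp | hnp | hnp
    · have hle : (n : ℝ) + 1 ≤ p := by exact_mod_cast hnp
      have hb := h.le p n
      rw [abs_of_pos (by linarith)] at hb
      have hd : 0 < (p : ℝ) - n := by linarith
      have hdist : (Nat.dist p n : ℝ) = (p : ℝ) + 1 - (n + 1) := by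
        rw [cast_dist_eq_abs_sub, abs_of_pos hd]; ring
      have h1 := rpow_ratio_le_of_lt (P := (p : ℝ) + 1) hn1 (by linarith) (le_max_right β 1)
        hδ1 hδ0
      rw [hdist]
      refine le_trans ?_ (mul_le_mul_of_nonneg_left h1 (by positivity))
      have h2 : (((p : ℝ) + 1) / ((n : ℝ) + 1)) ^ β ≤ (((p : ℝ) + 1) / ((n : ℝ) + 1)) ^ β' :=
        Real.rpow_le_rpow_of_exponent_le ((one_le_div (by linarith)).2 (by linarith))
          (le_max_left _ _)
      calc _ ≤ (((p : ℝ) + 1) / ((n : ℝ) + 1)) ^ β' /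
            (c * ((p : ℝ) + 1) ^ (α - 1) * ((p : ℝ) - n)) := by gcongr
        _ = _ := by
          rw [add_sub_add_right_eq_sub, mul_assoc, one_div, inv_mul_eq_div, div_div,
            mul_comm _ c]
    · subst hnp
      rw [sub_self, norm_zero, div_zero]
      positivity
    · have hle : (p : ℝ) + 1 ≤ n := by exact_mod_cast hnp
      have hb := h.le n p
      rw [abs_of_pos (by linarith), norm_sub_rev] at hb
      have hd : 0 < (n : ℝ) - p := by linarith
      have hdist : (Nat.dist p n : ℝ) = (n : ℝ) + 1 - (p + 1) := by
        rw [Nat.dist_comm, cast_dist_eq_abs_sub, abs_of_pos hd]; ring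
      have h1 := rpow_ratio_le_of_gt (N := (n : ℝ) + 1) hp1 (by linarith) (le_max_right (-β) 0)
        hδ2 hδ0
      rw [hdist]
      have h3 : 0 ≤ 1 / ((n : ℝ) + 1) ^ (1 + δ) := by positivity
      refine le_trans ?_ (mul_le_mul_of_nonneg_left (le_add_of_nonneg_of_le h3 h1) (by positivity))
      have h2 : (((p : ℝ) + 1) / ((n : ℝ) + 1)) ^ β ≤ (((n : ℝ) + 1) / ((p : ℝ) + 1)) ^ γ := by
        rw [← inv_div, Real.inv_rpow (by positivity), ← Real.rpow_neg (by positivity)]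
        exact Real.rpow_le_rpow_of_exponent_le ((one_le_div (by linarith)).2 (by linarith))
          (le_max_left _ _)
      calc _ ≤ (((n : ℝ) + 1) / ((p : ℝ) + 1)) ^ γ /
            (c * ((n : ℝ) + 1) ^ (α - 1) * ((n : ℝ) - p)) := by gcongr
        _ = _ := by
          rw [add_sub_add_right_eq_sub, mul_assoc, one_div, inv_mul_eq_div, div_div,
            mul_comm _ c]
  refine (Finset.sum_le_sum hterm).trans ?_
  rw [← Finset.mul_sum, Finset.sum_add_distrib]
  have h4 : ∑ n ∈ s, 1 / ((n : ℝ) + 1) ^ (1 + δ) ≤ Z :=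
    hs.sum_le_tsum _ fun n _ => by positivity
  have h5 := sum_dist_le (g := fun d : ℕ => 1 / (d : ℝ) ^ (1 + δ)) (fun d => by positivity) hs' p s
  have h6 := mul_le_mul_of_nonneg_left (add_le_add h4 h5) (by positivity : 0 ≤ 1 / c)
  linarith

/-- The kernel dominating the backstepping transformation on the domain of a fractional power. -/
noncomputable def cauchyKernel (a : ℕ → ℂ) (σ : ℝ) (p n : ℕ) : ℝ :=
  (((p : ℝ) + 1) / ((n : ℝ) + 1)) ^ σ / ‖a p - a n‖ + if n = p then 1 else 0

/-- With weights `(n+1)^{-1/2}` rows give the ratio sum with exponent `σ + 1/2`, columns with `1/2 -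
σ`. The conditions `σ + 1/2 < α` and `1/2 - σ > 1 - α` coincide: both say `σ < α - 1/2`. -/
lemma GapBound.exists_schurBound {a : ℕ → ℂ} {α c : ℝ} (h : GapBound a α c) {σ : ℝ}
    (hσ : 0 ≤ σ) (hσ' : σ < α - 1 / 2) :
    ∃ A : ℝ, 0 < A ∧
      SchurBound (cauchyKernel a σ) (fun n => ((n : ℝ) + 1) ^ (-(1 / 2) : ℝ)) A := by
  have hα := h.one_lt
  obtain ⟨A₁, hA₁, h₁⟩ := h.exists_sum_ratio_le (β := σ + 1 / 2) (by linarith) (by linarith)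
  obtain ⟨A₂, hA₂, h₂⟩ := h.exists_sum_ratio_le (β := 1 / 2 - σ) (by linarith) (by linarith)
  have hw : ∀ n : ℕ, 0 < ((n : ℝ) + 1) ^ (-(1 / 2) : ℝ) := fun n => by positivity
  have hdiag : ∀ (p : ℕ) (s : Finset ℕ) (x : ℝ), 0 ≤ x →
      ∑ n ∈ s, (if n = p then x else 0) ≤ x := fun p s x hx => by
    rw [Finset.sum_ite_eq']
    split_ifs
    · exact le_rfl
    · exact hx
  refine ⟨A₁ + A₂ + 1, by positivity, ⟨fun p n => ?_, hw, fun p s => ?_, fun n s => ?_⟩⟩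
  · unfold cauchyKernel
    split_ifs <;> positivity
  · have e : ∀ n, cauchyKernel a σ p n * ((n : ℝ) + 1) ^ (-(1 / 2) : ℝ) =
        (((p : ℝ) + 1) / ((n : ℝ) + 1)) ^ (σ + 1 / 2) / ‖a p - a n‖ *
          ((p : ℝ) + 1) ^ (-(1 / 2) : ℝ) +
        if n = p then ((p : ℝ) + 1) ^ (-(1 / 2) : ℝ) else 0 := by
      intro n
      unfold cauchyKernel
      rw [add_mul]
      congr 1
      · rw [Real.rpow_add (by positivity), Real.div_rpow (by positivity) (by positivity) (1 / 2),
          Real.rpow_neg (by positivity), Real.rpow_neg (by positivity)]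
        have : ((p : ℝ) + 1) ^ (1 / 2 : ℝ) ≠ 0 := by positivity
        field_simp
      · split_ifs with hnp
        · rw [hnp, one_mul]
        · rw [zero_mul]
    simp only [e]
    rw [Finset.sum_add_distrib, ← Finset.sum_mul]
    have h3 := mul_le_mul_of_nonneg_right (h₁ p s) (hw p).le
    have h4 := hdiag p s _ (hw p).le
    nlinarith [mul_pos hA₂ (hw p)]
  · have e : ∀ p, cauchyKernel a σ p n * ((p : ℝ) + 1) ^ (-(1 / 2) : ℝ) =
        (((n : ℝ) + 1) / ((p : ℝ) + 1)) ^ (1 / 2 - σ) / ‖a n - a p‖ *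
          ((n : ℝ) + 1) ^ (-(1 / 2) : ℝ) +
        if p = n then ((n : ℝ) + 1) ^ (-(1 / 2) : ℝ) else 0 := by
      intro p
      unfold cauchyKernel
      rw [add_mul]
      congr 1
      · rw [Real.rpow_sub (by positivity), Real.div_rpow (by positivity) (by positivity) (1 / 2),
          Real.rpow_neg (by positivity), Real.rpow_neg (by positivity), norm_sub_rev,
          Real.div_rpow (by positivity) (by positivity) σ,
          Real.div_rpow (by positivity) (by positivity) σ]
        have : ((p : ℝ) + 1) ^ (1 / 2 : ℝ) ≠ 0 := by positivity
        have : ((n : ℝ) + 1) ^ (1 / 2 : ℝ) ≠ 0 := by positivity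
        have : ((p : ℝ) + 1) ^ σ ≠ 0 := by positivity
        have : ((n : ℝ) + 1) ^ σ ≠ 0 := by positivity
        field_simp
      · rcases eq_or_ne n p with hnp | hnp
        · rw [if_pos hnp, if_pos hnp.symm, hnp, one_mul]
        · rw [if_neg hnp, if_neg hnp.symm, zero_mul]
    simp only [e]
    rw [Finset.sum_add_distrib, ← Finset.sum_mul]
    have h3 := mul_le_mul_of_nonneg_right (h₂ n s) (hw n).le
    have h4 := hdiag n s _ (hw n).le
    nlinarith [mul_pos hA₁ (hw n)]

lemma SchurBound.const_mul {κ : ℕ → ℕ → ℝ} {w : ℕ → ℝ} {A : ℝ} (h : SchurBound κ w A) {G : ℝ}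
    (hG : 0 ≤ G) : SchurBound (fun p n => G * κ p n) w (G * A) where
  nonneg p n := mul_nonneg hG (h.nonneg p n)
  pos := h.pos
  row p s := by
    simp only [mul_assoc]
    rw [← Finset.mul_sum]
    exact mul_le_mul_of_nonneg_left (h.row p s) hG
  col n s := by
    simp only [mul_assoc]
    rw [← Finset.mul_sum]
    exact mul_le_mul_of_nonneg_left (h.col n s) hG

end Backstepping

namespace Backstepping

open scoped NNReal

/-! ### Diagonal semigroups on `ℓ²` and their conjugates -/

lemma ell2_tendsto_of_dominated {ι : Type*} {l : Filter ι} {F : ι → Ell2} {G : Ell2}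
    {b : ℕ → ℝ} (hb : Summable fun n => b n ^ 2)
    (hlim : ∀ n, Tendsto (fun i => F i n) l (𝓝 (G n)))
    (hle : ∀ᶠ i in l, ∀ n, ‖F i n - G n‖ ≤ b n) : Tendsto F l (𝓝 G) := by
  rw [tendsto_iff_norm_sub_tendsto_zero]
  have h1 : ∀ i, ‖F i - G‖ ^ 2 = ∑' n, ‖F i n - G n‖ ^ 2 := fun i => by
    have h := lp.norm_rpow_eq_tsum (p := 2) (by norm_num) (F i - G)
    simp only [ENNReal.toReal_ofNat, Real.rpow_two] at h
    exact h
  have h2 : Tendsto (fun i => ∑' n, ‖F i n - G n‖ ^ 2) l (𝓝 (∑' _ : ℕ, (0 : ℝ))) := by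
    refine tendsto_tsum_of_dominated_convergence hb (fun n => ?_) ?_
    · have := (tendsto_iff_norm_sub_tendsto_zero.1 (hlim n)).pow 2
      simpa using this
    · filter_upwards [hle] with i hi n
      rw [norm_pow, norm_norm]
      exact pow_le_pow_left₀ (norm_nonneg _) (hi n) 2
  rw [tsum_zero] at h2
  have h3 := (Real.continuous_sqrt.tendsto 0).comp h2
  rw [Real.sqrt_zero] at h3
  refine h3.congr fun i => ?_
  rw [Function.comp_apply, ← h1, Real.sqrt_sq (norm_nonneg _)]

/-- Multiplication by a bounded sequence, on `ℓ²`. -/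
noncomputable def diagCLM (m : ℕ → ℂ) (C : ℝ) (h : ∀ n, ‖m n‖ ≤ C) : Ell2 →L[ℂ] Ell2 :=
  LinearMap.mkContinuous
    { toFun := fun f => ⟨fun n => m n * f n, memℓp_two_of_norm_le f.2 C fun n => by
        rw [norm_mul]
        exact mul_le_mul_of_nonneg_right (h n) (norm_nonneg _)⟩
      map_add' := fun f g => by
        ext n
        exact mul_add _ _ _
      map_smul' := fun c f => by
        ext n
        exact mul_left_comm _ _ _ } C fun f => by
    have hC : 0 ≤ C := (norm_nonneg _).trans (h 0)
    refine ell2_norm_le (mul_nonneg hC (norm_nonneg _)) fun s => ?_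
    rw [mul_pow]
    refine le_trans ?_ (mul_le_mul_of_nonneg_left (ell2_sum_sq_le f s) (sq_nonneg C))
    rw [Finset.mul_sum]
    refine Finset.sum_le_sum fun n _ => ?_
    rw [← mul_pow]
    refine pow_le_pow_left₀ (norm_nonneg _) ?_ 2
    exact (norm_mul _ _).trans_le (mul_le_mul_of_nonneg_right (h n) (norm_nonneg _))

lemma norm_diagCLM_le {m : ℕ → ℂ} {C : ℝ} (h : ∀ n, ‖m n‖ ≤ C) : ‖diagCLM m C h‖ ≤ C :=
  LinearMap.mkContinuous_norm_le _ ((norm_nonneg _).trans (h 0)) _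

lemma norm_exp_mul_le {z : ℂ} {ω : ℝ} (hz : z.re ≤ -ω) (t : ℝ≥0) :
    ‖Complex.exp ((t : ℝ) * z)‖ ≤ Real.exp (-(ω * t)) := by
  rw [Complex.norm_exp, Real.exp_le_exp, Complex.re_ofReal_mul]
  nlinarith [t.coe_nonneg]

/-- Mean value inequality on the convex left half-plane, where `exp` and hence its derivative are
bounded by `1`. -/
lemma norm_exp_sub_one_le_of_re_nonpos {z : ℂ} (hz : z.re ≤ 0) :
    ‖Complex.exp z - 1‖ ≤ ‖z‖ := by
  have h := (convex_halfSpace_re_le 0).norm_image_sub_le_of_norm_hasDerivWithin_le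
    (f := Complex.exp) (f' := Complex.exp) (C := 1) (x := 0) (y := z)
    (fun x _ => (Complex.hasDerivAt_exp x).hasDerivWithinAt)
    (fun x hx => by
      rw [Complex.norm_exp]
      exact Real.exp_le_one_iff.2 hx) (by simp) hz
  simpa using h

lemma tendsto_exp_sub_one_div (z : ℂ) :
    Tendsto (fun h : ℝ≥0 => ((h : ℝ) : ℂ)⁻¹ * (Complex.exp ((h : ℝ) * z) - 1)) (𝓝[>] 0)
      (𝓝 z) := by
  have h1 : HasDerivAt (fun t : ℝ => Complex.exp ((t : ℂ) * z)) z 0 := by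
    have h2 : HasDerivAt (fun t : ℝ => (t : ℂ) * z) z 0 := by
      simpa using (Complex.ofRealCLM.hasDerivAt (x := (0 : ℝ))).mul_const z
    simpa using h2.cexp
  have h3 := hasDerivAt_iff_tendsto_slope_zero.1 h1
  have h4 : Tendsto (fun h : ℝ≥0 => (h : ℝ)) (𝓝[>] 0) (𝓝[≠] 0) := by
    refine tendsto_nhdsWithin_iff.2 ⟨?_, ?_⟩
    · exact (NNReal.continuous_coe.tendsto' 0 0 NNReal.coe_zero).mono_left nhdsWithin_le_nhds
    · filter_upwards [self_mem_nhdsWithin] with h hh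
      exact (NNReal.coe_pos.2 hh).ne'
  refine (h3.comp h4).congr fun h => ?_
  simp

/-- The semigroup conjugate to a diagonal one by an isomorphism with `ℓ²`. -/
theorem exists_semigroup_of_diagonal {X : Type*} [NormedAddCommGroup X] [NormedSpace ℂ X]
    (P : X →L[ℂ] Ell2) (Q : Ell2 →L[ℂ] X) (hPQ : ∀ f, P (Q f) = f) (hQP : ∀ x, Q (P x) = x)
    {d : ℕ → ℂ} {ω : ℝ} (hω : 0 ≤ ω) (hd : ∀ n, (d n).re ≤ -ω) :
    ∃ E : C0Semigroup X, (∀ t : ℝ≥0, ‖E.toFun t‖ ≤ ‖Q‖ * Real.exp (-(ω * t)) * ‖P‖) ∧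
      ∀ x y, Tendsto (fun h : ℝ≥0 => ((h : ℝ) : ℂ)⁻¹ • (E.toFun h x - x)) (𝓝[>] 0) (𝓝 y) ↔
        ∀ n, P y n = d n * P x n := by
  let D : ℝ≥0 → Ell2 →L[ℂ] Ell2 := fun t =>
    diagCLM (fun n => Complex.exp ((t : ℝ) * d n)) _ fun n => norm_exp_mul_le (hd n) t
  have hD : ∀ t f n, D t f n = Complex.exp ((t : ℝ) * d n) * f n := fun t f n => rfl
  have hexp1 : ∀ (t : ℝ≥0) n, ‖Complex.exp ((t : ℝ) * d n)‖ ≤ 1 := fun t n =>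
    (norm_exp_mul_le (hd n) t).trans
      (Real.exp_le_one_iff.2 (neg_nonpos.2 (mul_nonneg hω t.coe_nonneg)))
  have hDcont : ∀ f, Continuous fun t => D t f := by
    intro f
    refine continuous_iff_continuousAt.2 fun t => ?_
    refine ell2_tendsto_of_dominated (b := fun n => 2 * ‖f n‖) ?_ (fun n => ?_)
      (Eventually.of_forall fun r n => ?_)
    · simp only [mul_pow]
      exact (ell2_summable_sq f).mul_left _
    · simp only [hD]
      refine Continuous.tendsto (f := fun r : ℝ≥0 => Complex.exp ((r : ℝ) * d n) * f n) ?_ t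
      fun_prop
    · rw [hD, hD, ← sub_mul, norm_mul]
      refine mul_le_mul_of_nonneg_right ?_ (norm_nonneg _)
      exact (norm_sub_le _ _).trans (by linarith [hexp1 r n, hexp1 t n])
  have hDgen : ∀ f g : Ell2,
      Tendsto (fun h : ℝ≥0 => ((h : ℝ) : ℂ)⁻¹ • (D h f - f)) (𝓝[>] 0) (𝓝 g) ↔
        ∀ n, g n = d n * f n := by
    intro f g
    have hcoord : ∀ (h : ℝ≥0) n, (((h : ℝ) : ℂ)⁻¹ • (D h f - f)) n =
        ((h : ℝ) : ℂ)⁻¹ * (Complex.exp ((h : ℝ) * d n) - 1) * f n := by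
      intro h n
      change ((h : ℝ) : ℂ)⁻¹ * (D h f n - f n) = _
      rw [hD]
      ring
    have hlim : ∀ n, Tendsto (fun h : ℝ≥0 => (((h : ℝ) : ℂ)⁻¹ • (D h f - f)) n) (𝓝[>] 0)
        (𝓝 (d n * f n)) := fun n => by
      simp only [hcoord]
      exact (tendsto_exp_sub_one_div (d n)).mul_const _
    constructor
    · intro h n
      have h1 := ((lp.evalCLM ℂ (fun _ : ℕ => ℂ) n (p := 2)).continuous.tendsto g).comp h
      exact tendsto_nhds_unique h1 (hlim n)
    · intro h
      -- The difference quotients are bounded coordinatewise by `‖d n * f n‖ = ‖g n‖`, so `g` itself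
      -- provides the domination.
      refine ell2_tendsto_of_dominated (b := fun n => 2 * ‖g n‖) ?_ (fun n => ?_) ?_
      · simp only [mul_pow]
        exact (ell2_summable_sq g).mul_left _
      · rw [h n]
        exact hlim n
      · filter_upwards [self_mem_nhdsWithin] with r hr n
        have hr' : (0 : ℝ) < r := NNReal.coe_pos.2 hr
        rw [hcoord]
        refine (norm_sub_le _ _).trans ?_
        rw [two_mul]
        refine add_le_add ?_ le_rfl
        rw [h n, norm_mul, norm_mul, norm_mul, norm_inv, Complex.norm_real,
          Real.norm_of_nonneg hr'.le]
        refine mul_le_mul_of_nonneg_right ?_ (norm_nonneg _)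
        rw [inv_mul_le_iff₀ hr']
        refine (norm_exp_sub_one_le_of_re_nonpos ?_).trans_eq ?_
        · rw [Complex.re_ofReal_mul]
          exact mul_nonpos_of_nonneg_of_nonpos hr'.le ((hd n).trans (neg_nonpos.2 hω))
        · rw [norm_mul, Complex.norm_real, Real.norm_of_nonneg hr'.le]
  refine ⟨⟨fun t => (Q.comp (D t)).comp P, ?_, ?_, ?_⟩, ?_, ?_⟩
  · ext x
    have : D 0 (P x) = P x := by
      ext n
      rw [hD]
      simp
    simp [this, hQP]
  · intro t r
    ext x
    have : D (t + r) (P x) = D t (D r (P x)) := by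
      ext n
      rw [hD, hD, hD, NNReal.coe_add, Complex.ofReal_add, add_mul, Complex.exp_add, mul_assoc]
    simp [this, hPQ]
  · intro x
    exact Q.continuous.comp (hDcont (P x))
  · intro t
    refine (ContinuousLinearMap.opNorm_comp_le _ _).trans ?_
    refine mul_le_mul_of_nonneg_right ?_ (norm_nonneg _)
    refine (ContinuousLinearMap.opNorm_comp_le _ _).trans ?_
    exact mul_le_mul_of_nonneg_left (norm_diagCLM_le _) (norm_nonneg _)
  · intro x y
    rw [← hDgen]
    constructor
    · intro h
      refine ((P.continuous.tendsto y).comp h).congr fun r => ?_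
      simp [hPQ]
    · intro h
      have h1 := (Q.continuous.tendsto (P y)).comp h
      rw [hQP] at h1
      refine h1.congr fun r => ?_
      simp [hQP]

end Backstepping

namespace Backstepping

open scoped InnerProductSpace LinearPMap NNReal

/-! ### The spectrum and the graph of the closed loop in coordinates -/

namespace ControlSystem

variable {H : Type*} [NormedAddCommGroup H] [InnerProductSpace ℂ H] [CompleteSpace H]
  {S : ControlSystem H} {α : ℝ}

lemma Assumptions.exists_gapBound (hS : S.Assumptions α) : ∃ c, GapBound S.eig α c := by
  obtain ⟨c, hc, h⟩ := hS.gap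
  exact ⟨c, hS.one_lt, hc, h⟩

/-- Treats the two cases at once: the spectrum lies on the ray through `-1` or through `i`. -/
lemma Assumptions.exists_ray (hS : S.Assumptions α) : ∃ (ε : ℂ) (ν : ℕ → ℝ), ‖ε‖ = 1 ∧ ε.re ≤ 0 ∧
    Monotone ν ∧ (∀ n, 0 < ν n) ∧ ∀ n, S.eig n = ν n * ε := by
  rcases hS.sign with ⟨-, h⟩ | ⟨-, h⟩
  · refine ⟨-1, fun n => -(S.eig n).re, by simp, by simp,
      monotone_nat_of_le_succ fun n => (h n).2.2, fun n => (h n).2.1, fun n => ?_⟩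
    apply Complex.ext <;> simp [(h n).1]
  · refine ⟨Complex.I, fun n => (S.eig n).im, by simp, by simp,
      monotone_nat_of_le_succ fun n => (h n).2.2, fun n => (h n).2.1, fun n => ?_⟩
    apply Complex.ext <;> simp [(h n).1]

lemma Assumptions.eig_re_nonpos (hS : S.Assumptions α) (n : ℕ) : (S.eig n).re ≤ 0 := by
  obtain ⟨ε, ν, -, hε, -, hν, h⟩ := hS.exists_ray
  rw [h, Complex.re_ofReal_mul]
  exact mul_nonpos_of_nonneg_of_nonpos (hν n).le hε

/-- On a ray norms of differences are differences of norms. The lower bound is the gap to the first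
eigenvalue, with `n ≥ (n+1)/2`; the upper bound telescopes consecutive gaps. -/
lemma Assumptions.exists_eig_growth (hS : S.Assumptions α) : ∃ g G : ℝ, 0 < g ∧ 0 < G ∧
    ∀ n : ℕ, g * ((n : ℝ) + 1) ^ α ≤ ‖S.eig n‖ ∧ ‖S.eig n‖ ≤ G * ((n : ℝ) + 1) ^ α := by
  obtain ⟨ε, ν, hε, -, hmono, hν, h⟩ := hS.exists_ray
  obtain ⟨c, hc⟩ := hS.exists_gapBound
  obtain ⟨_, C, -, hC⟩ := hS.gap_succ
  have hα := hS.one_lt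
  have hc0 := hc.pos
  have hnorm : ∀ n, ‖S.eig n‖ = ν n := fun n => by
    rw [h, norm_mul, hε, mul_one, Complex.norm_real, Real.norm_of_nonneg (hν n).le]
  have hdiff : ∀ m n, m ≤ n → ‖S.eig n - S.eig m‖ = ν n - ν m := fun m n hmn => by
    rw [h, h, ← sub_mul, norm_mul, hε, mul_one, ← Complex.ofReal_sub, Complex.norm_real,
      Real.norm_of_nonneg (sub_nonneg.2 (hmono hmn))]
  have hC0 : 0 ≤ C := by
    have := (norm_nonneg _).trans (hC 0).2
    simpa using this
  have hsplit : ∀ n : ℕ, ((n : ℝ) + 1) ^ α = ((n : ℝ) + 1) ^ (α - 1) * ((n : ℝ) + 1) := fun n => by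
    have hn : (0 : ℝ) < (n : ℝ) + 1 := by positivity
    rw [Real.rpow_sub_one hn.ne', div_mul_cancel₀ _ hn.ne']
  refine ⟨min (ν 0) (c / 2), ν 0 + C, lt_min (hν 0) (by linarith),
    add_pos_of_pos_of_nonneg (hν 0) hC0, fun n => ⟨?_, ?_⟩⟩
  · rw [hnorm]
    rcases Nat.eq_zero_or_pos n with rfl | hn
    · simp
    · have h1 := hc.le n 0
      rw [hdiff 0 n (Nat.zero_le n), Nat.cast_zero, sub_zero, abs_of_nonneg (by positivity)] at h1
      have hn1 : (1 : ℝ) ≤ n := by exact_mod_cast hn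
      have h2 : 0 < ((n : ℝ) + 1) ^ (α - 1) := by positivity
      calc min (ν 0) (c / 2) * ((n : ℝ) + 1) ^ α ≤ c / 2 * ((n : ℝ) + 1) ^ α := by
            gcongr
            exact min_le_right _ _
        _ = c * ((n : ℝ) + 1) ^ (α - 1) * (((n : ℝ) + 1) / 2) := by rw [hsplit]; ring
        _ ≤ c * ((n : ℝ) + 1) ^ (α - 1) * n := by
            gcongr
            linarith
        _ ≤ ν n := by linarith [hν 0]
  · rw [hnorm]
    induction n with
    | zero => simpa using hC0
    | succ n ih =>
      have h1 := (hC n).2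
      rw [hdiff n (n + 1) (Nat.le_succ n)] at h1
      have h2 : ((n : ℝ) + 1) ^ (α - 1) ≤ (((n + 1 : ℕ) : ℝ) + 1) ^ (α - 1) := by
        refine Real.rpow_le_rpow (by positivity) ?_ (by linarith)
        push_cast
        linarith
      have h3 : ((n : ℝ) + 1) ^ (α - 1) * ((n : ℝ) + 2) ≤ (((n + 1 : ℕ) : ℝ) + 1) ^ α := by
        rw [hsplit (n + 1)]
        refine mul_le_mul h2 (by push_cast; linarith) (by positivity) (by positivity)
      have h4 := mul_le_mul_of_nonneg_left h3 (add_nonneg (hν 0).le hC0)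
      have h5 : 0 ≤ ν 0 * ((n : ℝ) + 1) ^ (α - 1) := mul_nonneg (hν 0).le (by positivity)
      have h6 := hsplit n
      rw [h6] at ih
      linarith

lemma Assumptions.exists_summable_eig (hS : S.Assumptions α) {r : ℝ} (hr : 1 < α * r) :
    Summable fun n => ‖S.eig n‖ ^ (-r) := by
  obtain ⟨g, G, hg, -, hgr⟩ := hS.exists_eig_growth
  have hα := hS.one_lt
  have hr0 : 0 < r := by
    by_contra h
    nlinarith [mul_nonneg (by linarith : 0 ≤ α) (by linarith : 0 ≤ -r)]
  refine Summable.of_nonneg_of_le (fun n => by positivity) (fun n => ?_)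
    ((summable_one_div_succ_rpow hr).mul_left (g ^ (-r)))
  have h1 : 0 < g * ((n : ℝ) + 1) ^ α := by positivity
  refine (Real.rpow_le_rpow_of_nonpos h1 (hgr n).1 (by linarith)).trans_eq ?_
  rw [Real.mul_rpow hg.le (by positivity), ← Real.rpow_mul (by positivity), mul_neg,
    Real.rpow_neg (by positivity) (α * r), one_div]

lemma inner_adj (x y : S.A.domain) : ⟪S.adj x, (y : H)⟫_ℂ = ⟪(x : H), S.A y⟫_ℂ := by
  have hd : Dense (S.A.domain : Set H) := by
    have h1 : (Submodule.span ℂ (Set.range S.φ)) ≤ S.A.domain :=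
      Submodule.span_le.2 (Set.range_subset_iff.2 S.φ_mem)
    have h2 : Dense (Submodule.span ℂ (Set.range S.φ) : Set H) :=
      Submodule.dense_iff_topologicalClosure_eq_top.2 S.φ.dense_span
    exact h2.mono h1
  exact LinearPMap.adjoint_isFormalAdjoint hd ⟨x, S.mem_adjoint_domain x⟩ y

lemma inner_adj_φ (x : S.A.domain) (n : ℕ) :
    ⟪S.adj x, S.φ n⟫_ℂ = S.eig n * ⟪(x : H), S.φ n⟫_ℂ := by
  have h := inner_adj x ⟨S.φ n, S.φ_mem n⟩
  rwa [S.A_φ, inner_smul_right] at h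

lemma adj_φ (n : ℕ) : S.adj ⟨S.φ n, S.φ_mem n⟩ = (starRingEnd ℂ) (S.eig n) • S.φ n := by
  apply S.φ.repr.injective
  ext m
  rw [HilbertBasis.repr_apply_apply, HilbertBasis.repr_apply_apply, inner_smul_right,
    ← inner_conj_symm, inner_adj_φ, map_mul, inner_conj_symm]
  rcases eq_or_ne m n with rfl | hmn
  · rfl
  · change _ * ⟪S.φ m, S.φ n⟫_ℂ = _
    rw [S.φ.orthonormal.2 hmn, mul_zero, mul_zero]

lemma inner_φ_A (x : S.A.domain) (n : ℕ) : ⟪S.φ n, S.A x⟫_ℂ = S.eig n * ⟪S.φ n, (x : H)⟫_ℂ := by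
  have h := inner_adj ⟨S.φ n, S.φ_mem n⟩ x
  rw [adj_φ, inner_smul_left, Complex.conj_conj] at h
  exact h.symm

/-- Expansion of the control functional along the eigenvectors. -/
lemma hasSum_B (x : S.A.domain) : HasSum (fun n => ⟪(x : H), S.φ n⟫_ℂ * S.b n) (S.B x) := by
  obtain ⟨M, hM⟩ := S.B_bound
  let e : ℕ → S.A.domain := fun n => ⟪S.φ n, (x : H)⟫_ℂ • ⟨S.φ n, S.φ_mem n⟩
  have he : ∀ s : Finset ℕ, ((∑ n ∈ s, e n : S.A.domain) : H) =
      ∑ n ∈ s, ⟪S.φ n, (x : H)⟫_ℂ • S.φ n := fun s => by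
    rw [Submodule.coe_sum]
    rfl
  have hAe : ∀ s : Finset ℕ, S.A (∑ n ∈ s, e n) = ∑ n ∈ s, ⟪S.φ n, S.A x⟫_ℂ • S.φ n := fun s => by
    refine (map_sum S.A.toFun e s).trans (Finset.sum_congr rfl fun n _ => ?_)
    refine (map_smul S.A.toFun _ _).trans ?_
    change _ • S.A ⟨S.φ n, S.φ_mem n⟩ = _
    rw [S.A_φ, smul_smul, inner_φ_A, mul_comm]
  have hBe : ∀ s : Finset ℕ, S.B (∑ n ∈ s, e n) = ∑ n ∈ s, ⟪(x : H), S.φ n⟫_ℂ * S.b n := fun s => by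
    rw [map_sum]
    refine Finset.sum_congr rfl fun n _ => ?_
    rw [LinearMap.map_smulₛₗ, inner_conj_symm, smul_eq_mul]
    rfl
  have hexp : ∀ y : H, HasSum (fun n => ⟪S.φ n, y⟫_ℂ • S.φ n) y := fun y => by
    have := S.φ.hasSum_repr y
    simpa only [HilbertBasis.repr_apply_apply] using this
  -- The eigenvector expansion of `x` converges in the graph norm, for which `B` is continuous.
  have h1 := tendsto_iff_norm_sub_tendsto_zero.1 (hexp (x : H))
  have h2 := tendsto_iff_norm_sub_tendsto_zero.1 (hexp (S.A x))
  have h3 := (h1.add h2).const_mul M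
  rw [add_zero, mul_zero] at h3
  refine tendsto_iff_norm_sub_tendsto_zero.2
    (squeeze_zero (fun _ => norm_nonneg _) (fun s => ?_) h3)
  have h4 := hM (∑ n ∈ s, e n - x)
  rw [map_sub, LinearPMap.map_sub, Submodule.coe_sub, he, hAe, hBe] at h4
  exact h4

/-- The graph of the closed loop in coordinates. -/
lemma mem_closedLoopGraph_iff {lam s : ℝ} {x y : S.DPow s} :
    (x, y) ∈ S.closedLoopGraph lam s ↔ Summable (S.Kterm lam (DPow.incl x)) ∧ ∀ n,
      S.eig n * ⟪S.φ n, DPow.incl x⟫_ℂ + (∑' m, S.Kterm lam (DPow.incl x) m) * S.b n =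
        ⟪S.φ n, DPow.incl y⟫_ℂ := by
  refine and_congr_right fun _ => ⟨fun h n => ?_, fun h z => ?_⟩
  · have h1 := h ⟨S.φ n, S.φ_mem n⟩
    rw [adj_φ, inner_smul_left, Complex.conj_conj] at h1
    exact h1
  · have h1 := S.φ.hasSum_inner_mul_inner (S.adj z) (DPow.incl x)
    have h2 := (hasSum_B z).mul_left (∑' m, S.Kterm lam (DPow.incl x) m)
    have h3 := S.φ.hasSum_inner_mul_inner (z : H) (DPow.incl y)
    refine (h1.add h2).unique (h3.congr_fun fun n => ?_)
    rw [← h n, inner_adj_φ]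
    ring

/-! ### The fractional power domains are isometric to `ℓ²` -/

lemma eig_rpow_pos (S : ControlSystem H) (n : ℕ) (s : ℝ) : 0 < ‖S.eig n‖ ^ s :=
  Real.rpow_pos_of_pos (norm_pos_iff.2 (S.eig_ne_zero n)) s

lemma Assumptions.toLp_surjective (hS : S.Assumptions α) {s : ℝ} (hs : 0 ≤ s) :
    Function.Surjective (DPow.toLp : S.DPow s →ₗ[ℂ] Ell2) := by
  intro f
  obtain ⟨g, G, hg, -, hgr⟩ := hS.exists_eig_growth
  have hα := hS.one_lt
  have hge : ∀ n, g ≤ ‖S.eig n‖ := fun n => by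
    refine le_trans ?_ (hgr n).1
    refine le_mul_of_one_le_right hg.le (Real.one_le_rpow ?_ (by linarith))
    linarith [(Nat.cast_nonneg n : (0 : ℝ) ≤ n)]
  have hmem : Memℓp (fun n => ((‖S.eig n‖ ^ s : ℝ) : ℂ)⁻¹ * f n) 2 := by
    refine memℓp_two_of_norm_le f.2 (g ^ s)⁻¹ fun n => ?_
    rw [norm_mul, norm_inv, Complex.norm_real, Real.norm_of_nonneg (S.eig_rpow_pos n s).le]
    gcongr
    exact hge n
  let h : H := S.φ.repr.symm ⟨_, hmem⟩
  have hh : ∀ n, ⟪S.φ n, h⟫_ℂ = ((‖S.eig n‖ ^ s : ℝ) : ℂ)⁻¹ * f n := fun n => by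
    rw [← HilbertBasis.repr_apply_apply]
    simp only [h, LinearIsometryEquiv.apply_symm_apply]
  have hw : S.weighted s h = f := by
    funext n
    rw [weighted, hh, mul_inv_cancel_left₀]
    exact Complex.ofReal_ne_zero.2 (S.eig_rpow_pos n s).ne'
  have hdom : h ∈ S.domPow s := by
    refine (S.memℓp_weighted_iff s h).1 ?_
    rw [hw]
    exact f.2
  refine ⟨(⟨h, hdom⟩ : S.domPow s), Subtype.ext hw⟩

/-- The isometry `D(A^s) ≃ ℓ²`. -/
noncomputable def Assumptions.toLpEquiv (hS : S.Assumptions α) {s : ℝ} (hs : 0 ≤ s) :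
    S.DPow s ≃ₗᵢ[ℂ] Ell2 :=
  LinearIsometryEquiv.ofSurjective ⟨DPow.toLp, fun _ => rfl⟩ (hS.toLp_surjective hs)

end ControlSystem

end Backstepping

namespace Backstepping

open scoped InnerProductSpace LinearPMap NNReal

namespace ControlSystem

variable {H : Type*} [NormedAddCommGroup H] [InnerProductSpace ℂ H] [CompleteSpace H]
  {S : ControlSystem H} {α : ℝ}

/-! ### The backstepping transformation -/

lemma Assumptions.b_ne_zero (hS : S.Assumptions α) (n : ℕ) : S.b n ≠ 0 := by
  obtain ⟨c, C, hc, h⟩ := hS.control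
  exact norm_pos_iff.1 (hc.trans_le (h n).1)

lemma tprod_subtype_ne {f : ℕ → ℂ} {i : ℕ} (hi : f i = 1) :
    ∏' m : {m : ℕ // m ≠ i}, f m = ∏' m, f m :=
  tprod_subtype_eq_of_mulSupport_subset (s := {m | m ≠ i}) fun m hm h => hm (by rw [h, hi])

lemma cauchyInv_eq (S : ControlSystem H) (lam : ℝ) (i j : ℕ) :
    S.cauchyInv lam i j = (lam : ℂ) ^ 2 / (S.eig j - S.eig i - lam) *
      cauchyTprod S.eig lam i * cauchyTprod S.eig (-lam) j := by
  rw [cauchyInv, cauchyTprod, cauchyTprod,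
    tprod_subtype_ne (f := fun m => 1 + (lam : ℂ) / (S.eig i - S.eig m)) (by simp),
    tprod_subtype_ne (f := fun n => 1 - (lam : ℂ) / (S.eig j - S.eig n)) (by simp)]
  simp only [neg_div, ← sub_eq_add_neg]

/-- The series defining the feedback is the row identity `hasSum_cauchyTprod_div` for the shift
`-lam`. -/
lemma k_eq {c : ℝ} (hg : GapBound S.eig α c) {lam D : ℝ} (hlam : lam ≠ 0)
    (h : Separated S.eig lam D) (n : ℕ) :
    S.k lam n = -lam * cauchyTprod S.eig lam n / S.b n := by
  have hl : (lam : ℂ) ≠ 0 := Complex.ofReal_ne_zero.2 hlam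
  have h1 := (hasSum_cauchyTprod_div hg h.neg (neg_ne_zero.2 hl) n).mul_left
    (-((lam : ℂ) ^ 2 * cauchyTprod S.eig lam n))
  have h2 : ∑' j, S.cauchyInv lam n j = -lam * cauchyTprod S.eig lam n := by
    refine Eq.trans (tsum_congr fun j => ?_) (h1.tsum_eq.trans ?_)
    · rw [cauchyInv_eq, sub_neg_eq_add,
        show S.eig n - S.eig j + lam = -(S.eig j - S.eig n - lam) by ring, div_neg]
      ring
    · field_simp
  rw [k, h2]

/-- The matrix of the backstepping transformation in the basis of eigenvectors. -/
noncomputable def bsMatrix (S : ControlSystem H) (μ : ℂ) (p n : ℕ) : ℂ :=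
  S.b p / S.b n * cauchyEntry S.eig μ p n

lemma tsum_bsMatrix_mul (hS : S.Assumptions α) {c : ℝ} (hg : GapBound S.eig α c) {μ : ℂ} {D : ℝ}
    (h : Separated S.eig μ D) (hμ : μ ≠ 0) (q p : ℕ) :
    ∑' n, S.bsMatrix μ q n * S.bsMatrix (-μ) n p = if q = p then 1 else 0 := by
  have e : ∀ n, S.bsMatrix μ q n * S.bsMatrix (-μ) n p =
      S.b q / S.b p * (cauchyEntry S.eig μ q n * cauchyEntry S.eig (-μ) n p) := fun n => by
    have := hS.b_ne_zero n
    unfold bsMatrix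
    field_simp
  simp only [e]
  rw [tsum_mul_left, tsum_cauchyEntry_mul hg h hμ]
  split_ifs with hqp
  · rw [hqp, mul_one, div_self (hS.b_ne_zero p)]
  · rw [mul_zero]

lemma hasSum_bsMatrix_mul_b (hS : S.Assumptions α) {c : ℝ} (hg : GapBound S.eig α c) {μ : ℂ}
    {D : ℝ} (h : Separated S.eig μ D) (hμ : μ ≠ 0) (p : ℕ) :
    HasSum (fun n => S.bsMatrix μ p n * S.b n) (S.b p) := by
  have h1 := (hasSum_cauchyEntry hg h hμ p).mul_left (S.b p)
  rw [mul_one] at h1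
  refine h1.congr_fun fun n => ?_
  have := hS.b_ne_zero n
  unfold bsMatrix
  field_simp

/-- The backstepping transformation intertwines the open and the closed loop. -/
lemma bsMatrix_intertwine (hS : S.Assumptions α) {c : ℝ} (hg : GapBound S.eig α c) {lam D : ℝ}
    (hlam : lam ≠ 0) (h : Separated S.eig lam D) {x y : ℕ → ℂ} {κ κ' u v : ℂ} {p : ℕ}
    (hxy : ∀ n, y n = S.eig n * x n + κ * S.b n)
    (hx : HasSum (fun n => S.bsMatrix lam p n * x n) u)
    (hy : HasSum (fun n => S.bsMatrix lam p n * y n) v)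
    (hk : HasSum (fun n => S.k lam n * x n) κ') :
    (S.eig p - lam) * u - v = S.b p * (κ' - κ) := by
  have hl : (lam : ℂ) ≠ 0 := Complex.ofReal_ne_zero.2 hlam
  have h1 := (hx.mul_left (S.eig p - lam)).sub hy
  have h2 := (hk.mul_left (S.b p)).sub ((hasSum_bsMatrix_mul_b hS hg h hl p).mul_left κ)
  refine (h1.unique (h2.congr_fun fun n => ?_)).trans (by ring)
  have hb := hS.b_ne_zero n
  have hd : S.eig p - S.eig n - lam ≠ 0 := sub_ne_zero.2 (h.sub_ne hl p n)
  rw [hxy, k_eq hg hlam h, bsMatrix, cauchyEntry]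
  field_simp
  ring

/-- The matrix of the backstepping transformation on `D(A^s)`, transported to `ℓ²`. -/
noncomputable def bsWeighted (S : ControlSystem H) (s : ℝ) (μ : ℂ) (p n : ℕ) : ℂ :=
  ((‖S.eig p‖ ^ s : ℝ) : ℂ) * S.bsMatrix μ p n * ((‖S.eig n‖ ^ s : ℝ) : ℂ)⁻¹

lemma tsum_bsWeighted_mul (hS : S.Assumptions α) {c : ℝ} (hg : GapBound S.eig α c) (s : ℝ) {μ : ℂ}
    {D : ℝ} (h : Separated S.eig μ D) (hμ : μ ≠ 0) (q p : ℕ) :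
    ∑' n, S.bsWeighted s μ q n * S.bsWeighted s (-μ) n p = if q = p then 1 else 0 := by
  have hne : ∀ n, ((‖S.eig n‖ ^ s : ℝ) : ℂ) ≠ 0 := fun n =>
    Complex.ofReal_ne_zero.2 (S.eig_rpow_pos n s).ne'
  have e : ∀ n, S.bsWeighted s μ q n * S.bsWeighted s (-μ) n p =
      ((‖S.eig q‖ ^ s : ℝ) : ℂ) * ((‖S.eig p‖ ^ s : ℝ) : ℂ)⁻¹ *
        (S.bsMatrix μ q n * S.bsMatrix (-μ) n p) := fun n => by
    have := hne n
    unfold bsWeighted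
    field_simp
  simp only [e]
  rw [tsum_mul_left, tsum_bsMatrix_mul hS hg h hμ]
  split_ifs with hqp
  · rw [hqp, mul_one, mul_inv_cancel₀ (hne p)]
  · rw [mul_zero]

lemma norm_cauchyEntry_le {a : ℕ → ℂ} {c : ℝ} (hg : GapBound a α c) {μ : ℂ} {D : ℝ}
    (h : Separated a μ D) (hμ : μ ≠ 0) (p n : ℕ) :
    ‖cauchyEntry a μ p n‖ ≤ Real.exp (2 * logSumConst α * ((‖μ‖ / c) ^ (1 / α) + 2)) *
      (‖μ‖ * D * (1 / ‖a p - a n‖) + if n = p then 1 else 0) := by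
  have hμ' : 0 < ‖μ‖ := norm_pos_iff.2 hμ
  rw [cauchyEntry, norm_div, norm_mul, norm_neg, div_eq_mul_one_div]
  calc ‖μ‖ * ‖cauchyTprod a μ n‖ * (1 / ‖a p - a n - μ‖)
      ≤ ‖μ‖ * Real.exp (2 * logSumConst α * ((‖μ‖ / c) ^ (1 / α) + 2)) *
        (D * (1 / ‖a p - a n‖) + if n = p then 1 / ‖μ‖ else 0) := by
        gcongr
        · exact hg.norm_cauchyTprod_le μ n
        · exact h.one_div_le hg.injective p n
    _ = _ := by
        split_ifs
        · field_simp
        · ring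

/-- The point is that `R` does not depend on `μ` or `D`. Since `|λ_n|` is of order `(n+1)^α`, the
weight of `D(A^s)` becomes the kernel exponent `σ = α * s`. -/
lemma Assumptions.exists_norm_bsWeighted_le (hS : S.Assumptions α) {c : ℝ}
    (hg : GapBound S.eig α c) {s : ℝ} (hs : 0 ≤ s) :
    ∃ R : ℝ, 0 < R ∧ ∀ (μ : ℂ) (D : ℝ), μ ≠ 0 → Separated S.eig μ D → ∀ p n,
      ‖S.bsWeighted s μ p n‖ ≤
        R * Real.exp (2 * logSumConst α * ((‖μ‖ / c) ^ (1 / α) + 2)) * (1 + ‖μ‖ * D) *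
          cauchyKernel S.eig (α * s) p n := by
  obtain ⟨g, G, hg0, hG0, hgr⟩ := hS.exists_eig_growth
  obtain ⟨cb, Cb, hcb, hb⟩ := hS.control
  have hCb : 0 < Cb := hcb.trans_le ((hb 0).1.trans (hb 0).2)
  refine ⟨Cb / cb * (G / g) ^ s, by positivity, fun μ D hμ h p n => ?_⟩
  have hD := h.pos hg.injective
  set E := Real.exp (2 * logSumConst α * ((‖μ‖ / c) ^ (1 / α) + 2)) with hE
  have hE0 : 0 < E := Real.exp_pos _
  have hratio : ‖S.eig p‖ ^ s * (‖S.eig n‖ ^ s)⁻¹ ≤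
      (G / g) ^ s * (((p : ℝ) + 1) / ((n : ℝ) + 1)) ^ (α * s) := by
    rw [← div_eq_mul_inv, ← Real.div_rpow (norm_nonneg _) (norm_nonneg _),
      Real.rpow_mul (by positivity), ← Real.mul_rpow (by positivity) (by positivity)]
    refine Real.rpow_le_rpow (by positivity) ?_ hs
    rw [Real.div_rpow (by positivity) (by positivity), div_mul_div_comm]
    exact div_le_div₀ (by positivity) (hgr p).2 (by positivity) (hgr n).1
  have hbb : ‖S.b p / S.b n‖ ≤ Cb / cb := by
    rw [norm_div]
    exact div_le_div₀ hCb.le (hb p).2 hcb (hb n).1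
  have hce := norm_cauchyEntry_le hg h hμ p n
  have hker : (((p : ℝ) + 1) / ((n : ℝ) + 1)) ^ (α * s) *
      (‖μ‖ * D * (1 / ‖S.eig p - S.eig n‖) + if n = p then 1 else 0) ≤
        (1 + ‖μ‖ * D) * cauchyKernel S.eig (α * s) p n := by
    have hμD : 0 ≤ ‖μ‖ * D := by positivity
    unfold cauchyKernel
    split_ifs with hnp
    · subst hnp
      rw [div_self (by positivity), Real.one_rpow, sub_self, norm_zero, div_zero]
      linarith
    · rw [add_zero, add_zero, add_mul, one_mul]
      have h0 : 0 ≤ (((p : ℝ) + 1) / ((n : ℝ) + 1)) ^ (α * s) / ‖S.eig p - S.eig n‖ := by positivity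
      have e : (((p : ℝ) + 1) / ((n : ℝ) + 1)) ^ (α * s) *
          (‖μ‖ * D * (1 / ‖S.eig p - S.eig n‖)) =
          ‖μ‖ * D * ((((p : ℝ) + 1) / ((n : ℝ) + 1)) ^ (α * s) / ‖S.eig p - S.eig n‖) := by ring
      rw [e]
      linarith
  have hpos : 0 ≤ ‖μ‖ * D * (1 / ‖S.eig p - S.eig n‖) + if n = p then (1 : ℝ) else 0 := by
    split_ifs <;> positivity
  have e : ‖S.bsWeighted s μ p n‖ = ‖S.eig p‖ ^ s * (‖S.eig n‖ ^ s)⁻¹ * ‖S.b p / S.b n‖ *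
      ‖cauchyEntry S.eig μ p n‖ := by
    rw [bsWeighted, bsMatrix, norm_mul, norm_mul, norm_mul, norm_inv, Complex.norm_real,
      Complex.norm_real, Real.norm_of_nonneg (S.eig_rpow_pos p s).le,
      Real.norm_of_nonneg (S.eig_rpow_pos n s).le]
    ring
  rw [e]
  calc ‖S.eig p‖ ^ s * (‖S.eig n‖ ^ s)⁻¹ * ‖S.b p / S.b n‖ * ‖cauchyEntry S.eig μ p n‖
      ≤ (G / g) ^ s * (((p : ℝ) + 1) / ((n : ℝ) + 1)) ^ (α * s) * (Cb / cb) *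
        (E * (‖μ‖ * D * (1 / ‖S.eig p - S.eig n‖) + if n = p then 1 else 0)) := by gcongr
    _ = Cb / cb * (G / g) ^ s * E * ((((p : ℝ) + 1) / ((n : ℝ) + 1)) ^ (α * s) *
        (‖μ‖ * D * (1 / ‖S.eig p - S.eig n‖) + if n = p then 1 else 0)) := by ring
    _ ≤ Cb / cb * (G / g) ^ s * E * ((1 + ‖μ‖ * D) * cauchyKernel S.eig (α * s) p n) := by gcongr
    _ = _ := by ring

lemma Assumptions.exists_bsWeighted_clm (hS : S.Assumptions α) {c : ℝ} (hg : GapBound S.eig α c)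
    {s : ℝ} (hs : 0 ≤ s) (hs' : s < 1 - 1 / (2 * α)) :
    ∃ R : ℝ, 0 < R ∧ ∀ (μ : ℂ) (D : ℝ), μ ≠ 0 → Separated S.eig μ D → ∃ T : Ell2 →L[ℂ] Ell2,
      ‖T‖ ≤ R * Real.exp (2 * logSumConst α * ((‖μ‖ / c) ^ (1 / α) + 2)) * (1 + ‖μ‖ * D) ∧
      ∀ f p, HasSum (fun n => S.bsWeighted s μ p n * f n) (T f p) := by
  have hα := hS.one_lt
  have hσ : α * s < α - 1 / 2 := by
    have h1 := mul_lt_mul_of_pos_left hs' (by linarith : 0 < α)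
    have h2 : α * (1 - 1 / (2 * α)) = α - 1 / 2 := by
      have : α ≠ 0 := by linarith
      field_simp
    linarith
  obtain ⟨A, hA, hsch⟩ := hg.exists_schurBound (mul_nonneg (by linarith) hs) hσ
  obtain ⟨R, hR, hle⟩ := hS.exists_norm_bsWeighted_le hg hs
  refine ⟨R * A, by positivity, fun μ D hμ h => ?_⟩
  have hD := h.pos hg.injective
  obtain ⟨T, hT, hsum⟩ := (hsch.const_mul (by positivity : 0 ≤ R *
    Real.exp (2 * logSumConst α * ((‖μ‖ / c) ^ (1 / α) + 2)) *
      (1 + ‖μ‖ * D))).exists_continuousLinearMap (hle μ D hμ h)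
  exact ⟨T, hT.trans_eq (by ring), hsum⟩

lemma hasSum_bsMatrix_of_bsWeighted {s : ℝ} {μ : ℂ} {x : ℕ → ℂ} {p : ℕ} {u : ℂ}
    (h : HasSum (fun n => S.bsWeighted s μ p n * (((‖S.eig n‖ ^ s : ℝ) : ℂ) * x n))
      (((‖S.eig p‖ ^ s : ℝ) : ℂ) * u)) :
    HasSum (fun n => S.bsMatrix μ p n * x n) u := by
  have hne : ∀ n, ((‖S.eig n‖ ^ s : ℝ) : ℂ) ≠ 0 := fun n =>
    Complex.ofReal_ne_zero.2 (S.eig_rpow_pos n s).ne'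
  have h1 := h.mul_left ((‖S.eig p‖ ^ s : ℝ) : ℂ)⁻¹
  rw [inv_mul_cancel_left₀ (hne p)] at h1
  refine h1.congr_fun fun n => ?_
  have := hne n
  have := hne p
  unfold bsWeighted
  field_simp

lemma norm_k_le {c : ℝ} (hg : GapBound S.eig α c) {lam D cb : ℝ} (hlam : 0 < lam) (hcb : 0 < cb)
    (hb : ∀ n, cb ≤ ‖S.b n‖) (h : Separated S.eig lam D) (n : ℕ) :
    ‖S.k lam n‖ ≤
      lam * Real.exp (2 * logSumConst α * ((lam / c) ^ (1 / α) + 2)) / cb := by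
  have h1 := hg.norm_cauchyTprod_le (lam : ℂ) n
  rw [Complex.norm_real, Real.norm_of_nonneg hlam.le] at h1
  rw [k_eq hg hlam.ne' h, norm_div, norm_mul, norm_neg, Complex.norm_real,
    Real.norm_of_nonneg hlam.le]
  exact div_le_div₀ (by positivity) (mul_le_mul_of_nonneg_left h1 hlam.le) hcb (hb n)

/-- The graph of the closed loop is the pull back, under the backstepping transformation, of the
graph of the diagonal operator `A - lam`. -/
lemma mem_closedLoopGraph_iff_of_bsWeighted (hS : S.Assumptions α) {c : ℝ}
    (hg : GapBound S.eig α c) {s lam D : ℝ} (hs : 0 ≤ s) (hlam : 0 < lam)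
    (h : Separated S.eig lam D) {T T' : Ell2 →L[ℂ] Ell2}
    (hT : ∀ f p, HasSum (fun n => S.bsWeighted s lam p n * f n) (T f p))
    (hT' : ∀ f p, HasSum (fun n => S.bsWeighted s (-lam) p n * f n) (T' f p))
    (hTT : ∀ f, T' (T f) = f) (x y : S.DPow s) :
    (x, y) ∈ S.closedLoopGraph lam s ↔ ∀ n, T (hS.toLpEquiv hs y) n =
      (S.eig n - lam) * T (hS.toLpEquiv hs x) n := by
  have hl : (lam : ℂ) ≠ 0 := Complex.ofReal_ne_zero.2 hlam.ne'
  set w : ℕ → ℂ := fun n => ((‖S.eig n‖ ^ s : ℝ) : ℂ) with hw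
  have hne : ∀ n, w n ≠ 0 := fun n => Complex.ofReal_ne_zero.2 (S.eig_rpow_pos n s).ne'
  have hfwd : ∀ (z : S.DPow s) p, HasSum (fun n => S.bsMatrix lam p n * ⟪S.φ n, DPow.incl z⟫_ℂ)
      ((w p)⁻¹ * T (hS.toLpEquiv hs z) p) := fun z p => by
    refine hasSum_bsMatrix_of_bsWeighted (s := s) ?_
    rw [mul_inv_cancel_left₀ (hne p)]
    exact hT (hS.toLpEquiv hs z) p
  have hbwd : ∀ (z : S.DPow s) p, HasSum (fun n => S.bsMatrix (-lam) p n *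
      ((w n)⁻¹ * T (hS.toLpEquiv hs z) n)) ⟪S.φ p, DPow.incl z⟫_ℂ := fun z p => by
    refine hasSum_bsMatrix_of_bsWeighted (s := s) ?_
    have h1 := hT' (T (hS.toLpEquiv hs z)) p
    rw [hTT] at h1
    refine h1.congr_fun fun n => ?_
    rw [mul_inv_cancel_left₀ (hne n)]
  rw [mem_closedLoopGraph_iff]
  constructor
  · rintro ⟨hsum, hxy⟩ p
    have h1 := bsMatrix_intertwine hS hg hlam.ne' h (fun n => (hxy n).symm) (hfwd x p) (hfwd y p)
      hsum.hasSum
    rw [sub_self, mul_zero, mul_left_comm, ← mul_sub, mul_eq_zero] at h1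
    exact (sub_eq_zero.1 (h1.resolve_left (inv_ne_zero (hne p)))).symm
  · intro hxy
    -- Applying the inverse transformation, the factor `λ_j - lam - λ_n` cancels the Cauchy
    -- denominator. The series for `(y_n - λ_n x_n) / b_n` no longer contains `n`, so `y = A x + κ
    -- B` for one scalar `κ`.
    have hcoord : ∀ n, HasSum (fun j => -((S.b j)⁻¹ * lam * cauchyTprod S.eig (-lam) j *
        ((w j)⁻¹ * T (hS.toLpEquiv hs x) j)))
        ((S.b n)⁻¹ * (⟪S.φ n, DPow.incl y⟫_ℂ - S.eig n * ⟪S.φ n, DPow.incl x⟫_ℂ)) := by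
      intro n
      refine (((hbwd y n).sub ((hbwd x n).mul_left (S.eig n))).mul_left (S.b n)⁻¹).congr_fun
        fun j => ?_
      have hd : S.eig n - S.eig j + lam ≠ 0 := by
        have := sub_ne_zero.2 (h.neg.sub_ne (neg_ne_zero.2 hl) n j)
        rwa [sub_neg_eq_add] at this
      have := hS.b_ne_zero n
      have := hS.b_ne_zero j
      have := hne j
      rw [hxy j, bsMatrix, cauchyEntry, sub_neg_eq_add]
      field_simp
      ring
    set κ := (S.b 0)⁻¹ * (⟪S.φ 0, DPow.incl y⟫_ℂ - S.eig 0 * ⟪S.φ 0, DPow.incl x⟫_ℂ) with hκ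
    have hyx : ∀ n, ⟪S.φ n, DPow.incl y⟫_ℂ = S.eig n * ⟪S.φ n, DPow.incl x⟫_ℂ + κ * S.b n := by
      intro n
      have h1 := (hcoord n).unique (hcoord 0)
      rw [← hκ, inv_mul_eq_iff_eq_mul₀ (hS.b_ne_zero n)] at h1
      linear_combination h1
    -- From `x_n = (y_n - κ b_n) / λ_n = O(1/|λ_n|)` and bounded `k_n`: the feedback is defined on
    -- the domain even when it is not continuous on `D(A^s)`.
    have hsum : Summable (S.Kterm lam (DPow.incl x)) := by
      obtain ⟨cb, Cb, hcb, hb⟩ := hS.control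
      have hk := norm_k_le hg hlam hcb (fun n => (hb n).1) h
      set M := lam * Real.exp (2 * logSumConst α * ((lam / c) ^ (1 / α) + 2)) / cb
      have hM : 0 ≤ M := (norm_nonneg _).trans (hk 0)
      have hs1 := hS.exists_summable_eig (r := 1) (by rw [mul_one]; exact hS.one_lt)
      refine Summable.of_norm_bounded
        (hs1.mul_left (M * (‖DPow.incl y‖ + ‖κ‖ * Cb))) fun n => ?_
      have he := S.eig_ne_zero n
      have hx : ⟪S.φ n, DPow.incl x⟫_ℂ =
          (⟪S.φ n, DPow.incl y⟫_ℂ - κ * S.b n) * (S.eig n)⁻¹ := by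
        rw [hyx n]
        field_simp
        ring
      rw [Kterm, hx, norm_mul, norm_mul, norm_inv, Real.rpow_neg_one, mul_assoc M]
      refine mul_le_mul (hk n) ?_ (by positivity) hM
      refine mul_le_mul_of_nonneg_right ?_ (by positivity)
      refine (norm_sub_le _ _).trans (add_le_add ?_ ?_)
      · refine (norm_inner_le_norm _ _).trans_eq ?_
        rw [S.φ.orthonormal.1 n, one_mul]
      · rw [norm_mul]
        exact mul_le_mul_of_nonneg_left (hb n).2 (norm_nonneg _)
    have hK : ∑' m, S.Kterm lam (DPow.incl x) m = κ := by
      have h1 := bsMatrix_intertwine hS hg hlam.ne' h hyx (hfwd x 0) (hfwd y 0) hsum.hasSum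
      rw [hxy 0, mul_left_comm, sub_self, eq_comm, mul_eq_zero] at h1
      exact sub_eq_zero.1 (h1.resolve_left (hS.b_ne_zero 0))
    exact ⟨hsum, fun n => by rw [hK, hyx n]⟩

end ControlSystem

end Backstepping

namespace Backstepping

open scoped InnerProductSpace LinearPMap NNReal

namespace ControlSystem

variable {H : Type*} [NormedAddCommGroup H] [InnerProductSpace ℂ H] [CompleteSpace H]
  {S : ControlSystem H} {α : ℝ}

/-! ### The closed-loop semigroup and the feedback functional -/

lemma Assumptions.exists_feedback (hS : S.Assumptions α) {c : ℝ} (hg : GapBound S.eig α c) {s : ℝ}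
    (hs0 : 0 ≤ s) (hs : 1 / (2 * α) < s) :
    ∃ R : ℝ, 0 < R ∧ ∀ lam D : ℝ, 0 < lam → Separated S.eig lam D →
      ∃ L : S.DPow s →L[ℂ] ℂ, S.IsFeedbackOn lam s L ∧
        ‖L‖ ≤ R * lam * Real.exp (2 * logSumConst α * ((lam / c) ^ (1 / α) + 2)) := by
  have hα := hS.one_lt
  obtain ⟨cb, Cb, hcb, hb⟩ := hS.control
  have hsum : Summable fun n => ‖S.eig n‖ ^ (-(2 * s)) := by
    refine hS.exists_summable_eig ?_
    rw [div_lt_iff₀ (by linarith)] at hs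
    linarith
  set Z := ∑' n, ‖S.eig n‖ ^ (-(2 * s)) with hZ
  have hZ0 : 0 ≤ Z := tsum_nonneg fun n => by positivity
  refine ⟨(Real.sqrt Z + 1) / cb, by positivity, fun lam D hlam h => ?_⟩
  have hk := norm_k_le hg hlam hcb (fun n => (hb n).1) h
  set E := Real.exp (2 * logSumConst α * ((lam / c) ^ (1 / α) + 2)) with hE
  have hE0 : 0 < E := Real.exp_pos _
  set M := lam * E / cb with hM
  have hM0 : 0 ≤ M := by positivity
  -- The Riesz representative of the feedback in weighted coordinates, conjugated because the inner
  -- product is antilinear in its first argument.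
  let v : ℕ → ℂ := fun n => (starRingEnd ℂ) (S.k lam n) * ((‖S.eig n‖ ^ s : ℝ) : ℂ)⁻¹
  have hv : ∀ t : Finset ℕ, ∑ n ∈ t, ‖v n‖ ^ 2 ≤ (M * Real.sqrt Z) ^ 2 := by
    intro t
    rw [mul_pow, Real.sq_sqrt hZ0]
    refine le_trans ?_ (mul_le_mul_of_nonneg_left
      (hsum.sum_le_tsum t fun n _ => by positivity) (sq_nonneg M))
    rw [Finset.mul_sum]
    refine Finset.sum_le_sum fun n _ => ?_
    have e : ‖S.eig n‖ ^ (-(2 * s)) = (‖S.eig n‖ ^ s)⁻¹ ^ 2 := by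
      rw [Real.rpow_neg (norm_nonneg _), mul_comm 2 s, Real.rpow_mul (norm_nonneg _),
        Real.rpow_two, inv_pow]
    rw [e, ← mul_pow]
    refine pow_le_pow_left₀ (norm_nonneg _) ?_ 2
    rw [norm_mul, RCLike.norm_conj, norm_inv, Complex.norm_real,
      Real.norm_of_nonneg (S.eig_rpow_pos n s).le]
    exact mul_le_mul_of_nonneg_right (hk n) (inv_nonneg.2 (S.eig_rpow_pos n s).le)
  let V : Ell2 := ⟨v, memℓp_two_of_sum_le hv⟩
  have hV : ‖V‖ ≤ M * Real.sqrt Z := ell2_norm_le (by positivity) hv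
  refine ⟨(innerSL ℂ V).comp (hS.toLpEquiv hs0).toLinearIsometry.toContinuousLinearMap,
    fun f => ?_, ?_⟩
  · refine (lp.hasSum_inner V (hS.toLpEquiv hs0 f)).congr_fun fun n => ?_
    have hne : ((‖S.eig n‖ ^ s : ℝ) : ℂ) ≠ 0 :=
      Complex.ofReal_ne_zero.2 (S.eig_rpow_pos n s).ne'
    change S.k lam n * _ = ((‖S.eig n‖ ^ s : ℝ) : ℂ) * ⟪S.φ n, DPow.incl f⟫_ℂ *
      (starRingEnd ℂ) ((starRingEnd ℂ) (S.k lam n) * ((‖S.eig n‖ ^ s : ℝ) : ℂ)⁻¹)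
    rw [map_mul, Complex.conj_conj, map_inv₀, Complex.conj_ofReal]
    field_simp
  · refine (ContinuousLinearMap.opNorm_comp_le _ _).trans ?_
    rw [innerSL_apply_norm]
    calc ‖V‖ * ‖(hS.toLpEquiv hs0).toLinearIsometry.toContinuousLinearMap‖
        ≤ M * Real.sqrt Z * 1 := by
          gcongr
          exact LinearIsometry.norm_toContinuousLinearMap_le _
      _ ≤ M * (Real.sqrt Z + 1) := by linarith
      _ = _ := by rw [hM]; ring

/-- The square is the product of the bounds for the transformation and for its inverse, which is the
same operator with shift `-lam`. -/
lemma Assumptions.exists_closedLoop_semigroup (hS : S.Assumptions α) {c : ℝ}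
    (hg : GapBound S.eig α c) {s : ℝ} (hs : 0 ≤ s) (hs' : s < 1 - 1 / (2 * α)) :
    ∃ R : ℝ, 0 < R ∧ ∀ lam D : ℝ, 0 < lam → Separated S.eig lam D →
      ∃ E : C0Semigroup (S.DPow s), E.IsGenerator (S.closedLoop lam s) ∧
        ∀ t : ℝ≥0, ‖E.toFun t‖ ≤ R *
          (Real.exp (2 * logSumConst α * ((lam / c) ^ (1 / α) + 2)) * (1 + lam * D)) ^ 2 *
            Real.exp (-(lam * t)) := by
  obtain ⟨R, hR, hclm⟩ := hS.exists_bsWeighted_clm hg hs hs'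
  refine ⟨R ^ 2, by positivity, fun lam D hlam h => ?_⟩
  have hl : (lam : ℂ) ≠ 0 := Complex.ofReal_ne_zero.2 hlam.ne'
  have hl' : -(lam : ℂ) ≠ 0 := neg_ne_zero.2 hl
  have hln : ‖(lam : ℂ)‖ = lam := by rw [Complex.norm_real, Real.norm_of_nonneg hlam.le]
  obtain ⟨T, hTn, hT⟩ := hclm lam D hl h
  obtain ⟨T', hTn', hT'⟩ := hclm (-lam) D hl' h.neg
  rw [hln] at hTn
  rw [norm_neg, hln] at hTn'
  set X := Real.exp (2 * logSumConst α * ((lam / c) ^ (1 / α) + 2)) with hX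
  have hTT' : ∀ f, T (T' f) = f := matrix_comp_eq_id hT hT' (tsum_bsWeighted_mul hS hg s h hl)
  have hT'T : ∀ f, T' (T f) = f := by
    refine matrix_comp_eq_id hT' hT ?_
    have := tsum_bsWeighted_mul hS hg s h.neg hl'
    rwa [neg_neg] at this
  set U := hS.toLpEquiv hs with hU
  let P : S.DPow s →L[ℂ] Ell2 := T.comp U.toLinearIsometry.toContinuousLinearMap
  let Q : Ell2 →L[ℂ] S.DPow s := U.symm.toLinearIsometry.toContinuousLinearMap.comp T'
  have hP : ∀ x, P x = T (U x) := fun _ => rfl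
  have hQ : ∀ f, Q f = U.symm (T' f) := fun _ => rfl
  have hPn : ‖P‖ ≤ R * X * (1 + lam * D) := by
    refine (ContinuousLinearMap.opNorm_comp_le _ _).trans ((mul_le_of_le_one_right
      (norm_nonneg _) (LinearIsometry.norm_toContinuousLinearMap_le _)).trans hTn)
  have hQn : ‖Q‖ ≤ R * X * (1 + lam * D) := by
    refine (ContinuousLinearMap.opNorm_comp_le _ _).trans ((mul_le_of_le_one_left
      (norm_nonneg _) (LinearIsometry.norm_toContinuousLinearMap_le _)).trans hTn')
  obtain ⟨E, hE, hgen⟩ := exists_semigroup_of_diagonal P Q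
    (fun f => by rw [hP, hQ, LinearIsometryEquiv.apply_symm_apply, hTT'])
    (fun x => by rw [hP, hQ, hT'T, LinearIsometryEquiv.symm_apply_apply])
    (d := fun n => S.eig n - lam) hlam.le (fun n => by
      rw [Complex.sub_re, Complex.ofReal_re]
      linarith [hS.eig_re_nonpos n])
  refine ⟨E, fun x y => ?_, fun t => (hE t).trans ?_⟩
  · rw [closedLoop_graph, hgen]
    exact mem_closedLoopGraph_iff_of_bsWeighted hS hg hs hlam h hT hT' hT'T x y
  · have h0 : 0 ≤ R * X * (1 + lam * D) := (norm_nonneg _).trans hPn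
    calc ‖Q‖ * Real.exp (-(lam * t)) * ‖P‖
        ≤ R * X * (1 + lam * D) * Real.exp (-(lam * t)) * (R * X * (1 + lam * D)) := by gcongr
      _ = _ := by ring

end ControlSystem

end Backstepping

/-! ### Choice of the shift and collection of the constants. -/

theorem mainTheorem11 {H : Type*} [NormedAddCommGroup H] [InnerProductSpace ℂ H] [CompleteSpace H]
    (S : Backstepping.ControlSystem H) (α : ℝ) (hS : S.Assumptions α) :
    (∃ c : ℝ, 0 < c ∧ ∀ s : ℝ, 0 ≤ s → s < 1 - 1 / (2 * α) →
      ∃ C : ℝ, 0 < C ∧ ∀ N : ℕ, ∃ lam : ℝ, (N : ℝ) ≤ lam ∧ lam ≤ (N : ℝ) + 1 ∧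
        (lam : ℂ) ∉ S.resonant ∧
        ∃ E : Backstepping.C0Semigroup (S.DPow s),
          E.IsGenerator (S.closedLoop lam s) ∧
          (∀ (t : NNReal) (y : S.DPow s),
            ‖E.toFun t y‖ ≤
              C * Real.exp (c * lam ^ (1 / α)) * Real.exp (-(lam * (t : ℝ))) * ‖y‖) ∧
          (1 / (2 * α) < s →
            ∃ L : S.DPow s →L[ℂ] ℂ, S.IsFeedbackOn lam s L ∧
              ‖L‖ ≤ C * Real.exp (c * lam ^ (1 / α)) ∧
              ∀ (t : NNReal) (f : S.DPow s),
                ‖L (E.toFun t f)‖ ≤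
                  C * Real.exp (c * lam ^ (1 / α)) * Real.exp (-(lam * (t : ℝ))) * ‖f‖)) ∧
    (∀ s : ℝ, 1 / (2 * α) < s → s < 1 - 1 / (2 * α) →
      ∀ lam : ℝ, 0 < lam → (lam : ℂ) ∉ S.resonant →
        (∃ E : Backstepping.C0Semigroup (S.DPow s), E.IsGenerator (S.closedLoop lam s)) ∧
        ∃ L : S.DPow s →L[ℂ] ℂ, S.IsFeedbackOn lam s L) := by
  obtain ⟨c, hg⟩ := hS.exists_gapBound
  have hα := hS.one_lt
  have hc := hg.pos
  have hK := Backstepping.logSumConst_pos hα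
  refine ⟨?_, ?_⟩
  · obtain ⟨C₁, hC₁, hsep⟩ := hg.exists_separated_Icc
    obtain ⟨C₂, hC₂, hlin⟩ := Backstepping.exists_one_add_rpow_le_exp hα.le 1
    set K := 2 * Backstepping.logSumConst α with hKdef
    set c₁ := K * (1 / c) ^ (1 / α) with hc₁
    have hc₁0 : 0 < c₁ := by positivity
    -- The transformation, its inverse and `K` each cost `c₁ + 1`: `c₁` from the Cauchy products,
    -- `1` from absorbing a power of `lam`. The bound for `K` along trajectories uses all three.
    refine ⟨3 * c₁ + 3, by positivity, fun s hs hs' => ?_⟩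
    obtain ⟨R, hR, hsemi⟩ := hS.exists_closedLoop_semigroup hg hs hs'
    -- The constant must be fixed before `N`, whether or not `s` exceeds the threshold; below it `1`
    -- is a dummy value.
    obtain ⟨R', hR', hfeed⟩ : ∃ R' : ℝ, 0 < R' ∧ (1 / (2 * α) < s → ∀ lam D : ℝ, 0 < lam →
        Backstepping.Separated S.eig lam D → ∃ L : S.DPow s →L[ℂ] ℂ, S.IsFeedbackOn lam s L ∧
          ‖L‖ ≤ R' * lam * Real.exp (K * ((lam / c) ^ (1 / α) + 2))) := by
      by_cases hs1 : 1 / (2 * α) < s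
      · obtain ⟨R', hR', h⟩ := hS.exists_feedback hg hs hs1
        exact ⟨R', hR', fun _ => h⟩
      · exact ⟨1, one_pos, fun h => absurd h hs1⟩
    set A := R * (Real.exp (2 * K) * C₁) ^ 2 with hA
    set B := R' * (C₂ * Real.exp (2 * K)) with hB
    have hA0 : 0 < A := by positivity
    have hB0 : 0 < B := by positivity
    refine ⟨A + B + B * A, by positivity, fun N => ?_⟩
    obtain ⟨lam, D, hN, hN', hlam, hD, hle⟩ := hsep N
    have hres : (lam : ℂ) ∉ S.resonant := by
      rintro ⟨i, j, hij⟩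
      exact hD.sub_ne (Complex.ofReal_ne_zero.2 hlam.ne') i j hij.symm
    set x := lam ^ (1 / α) with hx
    have hx0 : 0 ≤ x := by positivity
    have hX : Real.exp (K * ((lam / c) ^ (1 / α) + 2)) = Real.exp (2 * K) * Real.exp (c₁ * x) := by
      rw [← Real.exp_add, hc₁, hx, div_eq_mul_one_div lam c,
        Real.mul_rpow hlam.le (by positivity)]
      congr 1
      ring
    have hexp : ∀ r, r ≤ 3 * c₁ + 3 → Real.exp (r * x) ≤ Real.exp ((3 * c₁ + 3) * x) :=
      fun r hr => Real.exp_le_exp.2 (mul_le_mul_of_nonneg_right hr hx0)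
    obtain ⟨E, hgen, hE⟩ := hsemi lam D hlam hD
    have hE' : ∀ t : NNReal, ‖E.toFun t‖ ≤
        A * Real.exp ((2 * c₁ + 2) * x) * Real.exp (-(lam * t)) := by
      intro t
      refine (hE t).trans (mul_le_mul_of_nonneg_right ?_ (Real.exp_pos _).le)
      rw [hX]
      have hD0 := hD.pos hg.injective
      calc R * (Real.exp (2 * K) * Real.exp (c₁ * x) * (1 + lam * D)) ^ 2
          ≤ R * (Real.exp (2 * K) * Real.exp (c₁ * x) * (C₁ * Real.exp x)) ^ 2 := by gcongr
        _ = A * (Real.exp (c₁ * x) * Real.exp x) ^ 2 := by rw [hA]; ring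
        _ = _ := by
          rw [← Real.exp_add, ← Real.exp_nat_mul]
          congr 2
          push_cast
          ring
    refine ⟨lam, hN, hN', hres, E, hgen, fun t y => ?_, fun hs1 => ?_⟩
    · refine ((E.toFun t).le_of_opNorm_le (hE' t) y).trans ?_
      gcongr ?_ * ?_ * _ * _
      · nlinarith [mul_pos hB0 hA0]
      · exact hexp _ (by linarith)
    · obtain ⟨L, hL, hLn⟩ := hfeed hs1 lam D hlam hD
      have hLn' : ‖L‖ ≤ B * Real.exp ((c₁ + 1) * x) := by
        refine hLn.trans ?_
        have h1 := hlin lam hlam.le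
        rw [Real.rpow_one] at h1
        rw [hX]
        calc R' * lam * (Real.exp (2 * K) * Real.exp (c₁ * x))
            ≤ R' * (C₂ * Real.exp x) * (Real.exp (2 * K) * Real.exp (c₁ * x)) := by
              gcongr
              linarith
          _ = B * (Real.exp (c₁ * x) * Real.exp x) := by rw [hB]; ring
          _ = _ := by
            rw [← Real.exp_add]
            congr 2
            ring
      refine ⟨L, hL, hLn'.trans ?_, fun t f => ?_⟩
      · gcongr ?_ * ?_
        · nlinarith [mul_pos hB0 hA0]
        · exact hexp _ (by linarith)
      · refine (L.le_of_opNorm_le hLn' _).trans ?_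
        have h1 := (E.toFun t).le_of_opNorm_le (hE' t) f
        calc B * Real.exp ((c₁ + 1) * x) * ‖E.toFun t f‖
            ≤ B * Real.exp ((c₁ + 1) * x) *
              (A * Real.exp ((2 * c₁ + 2) * x) * Real.exp (-(lam * t)) * ‖f‖) := by gcongr
          _ = B * A * (Real.exp ((c₁ + 1) * x) * Real.exp ((2 * c₁ + 2) * x)) *
              Real.exp (-(lam * t)) * ‖f‖ := by ring
          _ = B * A * Real.exp ((3 * c₁ + 3) * x) * Real.exp (-(lam * t)) * ‖f‖ := by
            rw [← Real.exp_add]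
            congr 4
            ring
          _ ≤ _ := by
            gcongr
            linarith
  · intro s hs hs' lam hlam hres
    have hs0 : 0 ≤ s := le_trans (by positivity) hs.le
    -- Without uniformity in `lam`, non-resonance alone gives some separation constant, as only
    -- finitely many differences come near `lam`.
    obtain ⟨D, hD⟩ := hg.exists_separated hlam fun i j hij => hres ⟨i, j, hij⟩
    obtain ⟨R, -, hsemi⟩ := hS.exists_closedLoop_semigroup hg hs0 hs'
    obtain ⟨R', -, hfeed⟩ := hS.exists_feedback hg hs0 hs
    obtain ⟨E, hE, -⟩ := hsemi lam D hlam hD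
    obtain ⟨L, hL, -⟩ := hfeed lam D hlam hD
    exact ⟨⟨E, hE⟩, L, hL⟩
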